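/- \textbf{Conventions.} A topological space $X$ is $n$-connected ($n\in\mathbb{Z}$) if every continuous map $S^{k-1}\to X$ extends to $D^{k}$ for all integers $0\le k\le n+1$; so $(-1)$-connected means non-empty, and there is no condition if $n\le -2$. A poset is $n$-connected if the geometric realization of the simplicial complex of its non-empty finite chains is. For an element $x$ of a poset $P$ let $\dim(x)$ be the supremum of the $m$ for which there is a chain $x_1<\cdots<x_m<x$. A poset $P$ in which every $\dim(x)$ is finite is \emph{weakly Cohen--Macaulay of dimension $n$} if $P$ is $(n-1)$-connected; for each $x\in P$ the poset $P_{<x}$ is $(\dim(x)-2)$-connected and the poset $P_{>x}$ is $(n-2-\dim(x))$-connected; and for each $x<y$ in $P$ the poset $P_{>x}\cap P_{<y}$ is $(\dim(y)-\dim(x)-3)$-connected. A simplicial complex is weakly Cohen--Macaulay of dimension $n$ if its face poset (its simplices ordered by inclusion) is. A finite set of elements of a finitely generated free $\mathbb{Z}$-module is \emph{unimodular} if it is a basis of a direct summand; an element $x$ is unimodular if $\{x\}$ is. \textbf{Theorem.} (1) Let $N$ be a finitely generated free $\mathbb{Z}$-module, $N'\subseteq N$ a submodule and $\delta\in N/N'$.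 Let $$t(N,N'):=\max\{\operatorname{rk}(U) : U\subseteq N' \text{ is a submodule that is a direct summand of } N\}.$$ Let $U^{\mathrm{unord}}(N,N',\delta)$ be the simplicial complex whose vertices are the unimodular elements $x\in N$ with $x \bmod N'=\delta$, and whose $p$-simplices are the sets of $p+1$ distinct vertices $\{x_0,\dots,x_p\}$ that are unimodular in $N$. Then $U^{\mathrm{unord}}(N,N',\delta)$ is weakly Cohen--Macaulay of dimension $t(N,N')-2$. (2) Let $M$ be a finitely generated free $\mathbb{Z}$-module, $M^\vee=\operatorname{Hom}(M,\mathbb{Z})$, $\lambda\colon M\otimes M\to\mathbb{Z}$ a skew-symmetric bilinear form, $\lambda^\vee\colon M\to M^\vee$ the map $m\mapsto\lambda(m,-)$, and $\delta\in M^\vee/\lambda^\vee(M)$. Let $t(M)$ be the maximal rank of a submodule $U\subseteq\lambda^\vee(M)$ that is a direct summand of $M^\vee$. Let $\mathcal{A}^{\mathrm{alg}}(M,\lambda,\delta)$ be the simplicial complex whose vertices are the unimodular $\alpha\in M^\vee$ with $\alpha\bmod\lambda^\vee(M)=\delta$, and whose $p$-simplices are the sets of $p+1$ distinct vertices that are unimodular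 in $M^\vee$. Then $\mathcal{A}^{\mathrm{alg}}(M,\lambda,\delta)$ is weakly Cohen--Macaulay of dimension $t(M)-2$. -/

import Mathlib

universe u v

/-! ### Connectivity of spaces and posets -/

/-- A topological space `X` is `n`-connected (`n : ℤ`) if every continuous map from the sphere
`S^(k-1)` to `X` extends to the disc `D^k`, for all natural numbers `k ≤ n + 1`.
The case `k = 0` (where `S^(-1) = ∅` and `D^0` is a point) says that `X` is non-empty; for
`n ≤ -2` the condition is empty. -/
def IsNConnected (X : Type u) [TopologicalSpace X] (n : ℤ) : Prop :=
  ∀ k : ℕ, (k : ℤ) ≤ n + 1 →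
    ∀ f : C(Metric.sphere (0 : EuclideanSpace ℝ (Fin k)) 1, X),
      ∃ g : C(Metric.closedBall (0 : EuclideanSpace ℝ (Fin k)) 1, X),
        ∀ x : Metric.sphere (0 : EuclideanSpace ℝ (Fin k)) 1,
          g ⟨x.1, Metric.sphere_subset_closedBall x.2⟩ = f x

namespace PreAbstractSimplicialComplex

variable {ι : Type u}

/-- The geometric realization of an abstract simplicial complex, as the set of barycentric
coordinates: non-negative finitely supported weights of total sum one whose support is a face. -/
def Realization (K : PreAbstractSimplicialComplex ι) : Type u :=
  {w : ι →₀ ℝ // (∀ i, 0 ≤ w i) ∧ (w.sum fun _ a => a) = 1 ∧ w.support ∈ K.faces}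

/-- The inclusion of the closed simplex spanned by a face `s` (extend weights by zero). -/
noncomputable def faceMap (K : PreAbstractSimplicialComplex ι) (s : K.faces)
    (x : stdSimplex ℝ s.1) : K.Realization :=
  ⟨(Finsupp.equivFunOnFinite.symm x.1).embDomain (Function.Embedding.subtype (· ∈ s.1)), by
    have hsum : (((Finsupp.equivFunOnFinite.symm x.1).embDomain
        (Function.Embedding.subtype (· ∈ s.1))).sum fun _ a => a) = 1 := by
      rw [Finsupp.sum_embDomain, Finsupp.sum_fintype _ _ (fun _ => rfl)]
      exact x.2.2
    refine ⟨fun i => ?_, hsum, (K.isRelLowerSet_faces s.2).2 ?_ ?_⟩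
    · by_cases hi : i ∈ s.1
      · have h := Finsupp.embDomain_apply_self (Function.Embedding.subtype (· ∈ s.1))
          (Finsupp.equivFunOnFinite.symm x.1) ⟨i, hi⟩
        have h' : (Function.Embedding.subtype (· ∈ s.1)) ⟨i, hi⟩ = i := rfl
        rw [h'] at h
        rw [h]
        exact x.2.1 ⟨i, hi⟩
      · rw [Finsupp.embDomain_of_notMem_range]
        rintro ⟨j, rfl⟩
        exact hi j.2
    · intro i hi
      rw [Finsupp.support_embDomain, Finset.mem_map] at hi
      obtain ⟨j, -, rfl⟩ := hi
      exact j.2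
    · rw [Finset.nonempty_iff_ne_empty]
      intro h
      rw [Finsupp.support_eq_empty] at h
      rw [h, Finsupp.sum_zero_index] at hsum
      exact zero_ne_one hsum⟩

/-- The weak topology: a set is open if and only if its intersection with every closed simplex
is open. -/
noncomputable instance realizationTopology (K : PreAbstractSimplicialComplex ι) : TopologicalSpace K.Realization :=
  ⨆ s : K.faces, TopologicalSpace.coinduced (K.faceMap s) inferInstance

end PreAbstractSimplicialComplex

/-- The simplicial complex associated to a poset: its simplices are the non-empty finite chains. -/
def orderComplex (P : Type u) [PartialOrder P] : PreAbstractSimplicialComplex P where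
  faces := {s | s.Nonempty ∧ IsChain (· ≤ ·) (s : Set P)}
  isRelLowerSet_faces := fun _ h =>
    ⟨h.1, fun _ hts ht => ⟨ht, h.2.mono (Finset.coe_subset.mpr hts)⟩⟩

/-- A poset is `n`-connected if the realization of its associated simplicial complex is. -/
def IsNConnectedPoset (P : Type u) [PartialOrder P] (n : ℤ) : Prop :=
  IsNConnected (orderComplex P).Realization n

/-! ### Weakly Cohen–Macaulay posets and complexes -/

/-- `f`-weakly Cohen–Macaulay posets of dimension `n`. -/
structure IsFWeaklyCohenMacaulay (P : Type u) [PartialOrder P] (f : P → ℤ) (n : ℤ) : Prop where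
  connected : IsNConnectedPoset P (n - 1)
  below : ∀ x : P, IsNConnectedPoset (Set.Iio x) (f x - 2)
  above : ∀ x : P, IsNConnectedPoset (Set.Ioi x) (n - 2 - f x)
  between : ∀ x y : P, x < y → IsNConnectedPoset (Set.Ioo x y) (f y - f x - 3)

/-- A poset is weakly Cohen–Macaulay of dimension `n` if it is `f`-weakly Cohen–Macaulay of
dimension `n` for `f x = dim x`, the supremum (required to be finite) of the `m` such that there
is a chain `x₁ < ⋯ < xₘ < x`. -/
def IsWeaklyCohenMacaulayPoset (P : Type u) [PartialOrder P] (n : ℤ) : Prop :=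
  (∀ x : P, Order.height x ≠ ⊤) ∧
    IsFWeaklyCohenMacaulay P (fun x => ((Order.height x).toNat : ℤ)) n

/-- A simplicial complex is weakly Cohen–Macaulay of dimension `n` if its face poset (its set of
simplices ordered by inclusion) is. -/
def IsWeaklyCohenMacaulay {ι : Type u} (K : PreAbstractSimplicialComplex ι) (n : ℤ) : Prop :=
  IsWeaklyCohenMacaulayPoset {s : Finset ι // s ∈ K.faces} n

/-! ### Unimodular sets -/

section Unimodular

variable (R : Type v) {N : Type u} [CommRing R] [AddCommGroup N] [Module R N]

/-- A finite set of elements of an `R`-module `N` (here `R = ℤ`) is unimodular if it is a basis of a direct summand of `N`: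
it is linearly independent and its span has a complement. -/
def IsUnimodularSet (s : Finset N) : Prop :=
  LinearIndepOn R id (s : Set N) ∧
    ∃ Q : Submodule R N, IsCompl (Submodule.span R (s : Set N)) Q

/-- An element `x` is unimodular if `{x}` is. -/
def IsUnimodular (x : N) : Prop := IsUnimodularSet R ({x} : Finset N)

variable {R}

theorem IsUnimodularSet.mono {s t : Finset N} (hs : IsUnimodularSet R s) (hts : t ⊆ s) :
    IsUnimodularSet R t := by
  classical
  obtain ⟨hli, Q, hQ⟩ := hs
  have hts' : (t : Set N) ⊆ s := Finset.coe_subset.mpr hts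
  refine ⟨hli.mono hts', Submodule.span R ((s : Set N) \ t) ⊔ Q, ?_⟩
  have hspan : Submodule.span R (t : Set N) ⊔ Submodule.span R ((s : Set N) \ t)
      = Submodule.span R (s : Set N) := by
    rw [← Submodule.span_union, Set.union_sdiff_cancel hts']
  have hdisj : Disjoint (Submodule.span R (t : Set N)) (Submodule.span R ((s : Set N) \ t)) := by
    have hu : (t : Set N) ∪ ((s : Set N) \ t) = s := Set.union_sdiff_cancel hts'
    have h := (linearIndepOn_union_iff (R := R) (v := (id : N → N)) (s := (t : Set N))
      (t := (s : Set N) \ t) Set.disjoint_sdiff_right).mp (by rw [hu]; exact hli)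
    simpa using h.2.2
  refine IsCompl.of_eq ?_ ?_
  · have h := hdisj.disjoint_sup_right_of_disjoint_sup_left (c := Q) (by
      rw [hspan]; exact hQ.disjoint)
    exact h.eq_bot
  · rw [← sup_assoc, hspan, hQ.sup_eq_top]

/-- The complex of unimodular vectors in the coset `δ ∈ N/N'`: its vertices are the unimodular
`x ∈ N` with `x mod N' = δ`, and a non-empty finite set of vertices is a simplex if and only if
it is unimodular in `N`. -/
def unimodularComplex (N' : Submodule R N) (δ : N ⧸ N') : PreAbstractSimplicialComplex N where
  faces := {s | s.Nonempty ∧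
    (∀ x ∈ s, IsUnimodular R x ∧ Submodule.Quotient.mk x = δ) ∧ IsUnimodularSet R s}
  isRelLowerSet_faces := fun _ h =>
    ⟨h.1, fun _ hts ht => ⟨ht, fun x hx => h.2.1 x (hts hx), h.2.2.mono hts⟩⟩

/-- `t(N, N')`: the maximal rank of a submodule `U ⊆ N'` that is a direct summand of `N`. -/
noncomputable def summandRank (N' : Submodule R N) : ℕ :=
  sSup {n : ℕ | ∃ U : Submodule R N, U ≤ N' ∧ (∃ Q : Submodule R N, IsCompl U Q) ∧
    Module.finrank R U = n}

/-- The supremum defining `t(N, N')` is a maximum when `N` is finitely generated. -/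
theorem summandRank_isGreatest [Nontrivial R] [Module.Finite R N] (N' : Submodule R N) :
    IsGreatest {n : ℕ | ∃ U : Submodule R N, U ≤ N' ∧ (∃ Q : Submodule R N, IsCompl U Q) ∧
      Module.finrank R U = n} (summandRank N') := by
  have hb : BddAbove {n : ℕ | ∃ U : Submodule R N, U ≤ N' ∧
      (∃ Q : Submodule R N, IsCompl U Q) ∧ Module.finrank R U = n} := by
    refine ⟨Module.finrank R N, ?_⟩
    rintro n ⟨U, -, -, rfl⟩
    exact Submodule.finrank_le U
  exact ⟨Nat.sSup_mem ⟨_, ⊥, bot_le, ⟨⊤, isCompl_bot_top⟩, rfl⟩ hb, fun n hn => le_csSup hb hn⟩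

end Unimodular

/-! ### The algebraic arc complex -/

section AlgebraicArcComplex

variable (M : Type u) [AddCommGroup M] [Module ℤ M]

/-- The form and the boundary class of a valid algebraic data on `M`: a skew-symmetric bilinear
form `form` on `M`, regarded as the linear map `λ^∨ : M → M^∨`, `m ↦ λ(m, -)`, and an element
`δ` of the cokernel `M^∨ / λ^∨(M)`. -/
structure AlgebraicData where
  form : LinearMap.BilinForm ℤ M
  skew : ∀ x y : M, form x y = -form y x
  δ : Module.Dual ℤ M ⧸ LinearMap.range form

variable {M}

/-- The algebraic arc complex: its vertices are the unimodular `α ∈ M^∨` with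
`α mod λ^∨(M) = δ`, and its simplices are the sets of vertices that are unimodular in `M^∨`. -/
def AlgebraicData.arcComplex (D : AlgebraicData M) :
    PreAbstractSimplicialComplex (Module.Dual ℤ M) :=
  unimodularComplex (LinearMap.range D.form) D.δ

/-- `t(M)`: the maximal rank of a submodule `U ⊆ λ^∨(M)` that is a direct summand of `M^∨`. -/
noncomputable def AlgebraicData.t (D : AlgebraicData M) : ℕ :=
  summandRank (LinearMap.range D.form)

end AlgebraicArcComplex

/-!
The statement reduces to the connectivity of complexes of unimodular sets. Below a simplex and
between two simplices the face poset is the boundary of a simplex, and above a simplex `s` it is the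
face poset of the link of `s`, so that `isWeaklyCohenMacaulay_of_links` leaves the connectivity of
the complex and of its links. Part (2) is part (1) for the submodule `λ^∨(M)` of `M^∨`.

A finite set is unimodular if and only if it has a dual family of functionals
(`isUnimodularSet_iff_isDualizable`). For a module `D` of functionals on `N` and `V ⊆ N`, let
`X D V` be the complex `dualizableFaces D V` of finite subsets of `V` with a dual family in `D`.
The link of a simplex `s` in `X D V` is `X D' V`, where `D'` consists of the functionals in `D` that
vanish on `s`. This replaces quotients of `N` by submodules of functionals on the fixed module `N`.

If `V` contains a coset of a summand of rank `t` (with a retraction having coordinates in `D`), then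
`X D V` is `(t - 3)`-connected (`HasAffineSummand.chainConnected`). This is proved together with the
sharper statement that `X D V` is `(t - 2)`-connected if `V` contains two such cosets, on which some
functional in `D` has the constant values `0` and `1` (`HasAffinePair.chainConnected`), by van der
Kallen's argument. Passing to the link of a vertex lowers `t` by at most one; for pairs of cosets
this uses a stable range argument over `ℤ` (`HasAffinePair.vanishingOn_singleton`). A coset of a
summand of rank `t + 1` contains a pair of cosets of a summand of rank `t`. Finally, a vertex `y` in
the second coset of a pair can be joined with all simplices in the first one; the remaining vertices
are added by `chainConnected_of_links`, which requires only that the links in what precedes are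
sufficiently connected.

All connectivity statements follow from one topological fact: a simplicial complex is `d`-connected
if the deletion of some vertex is `d`-connected and its link is `(d - 1)`-connected
(`PreAbstractSimplicialComplex.isNConnected_of_deletion_link`). It is proved by subdividing the
boundary of a cube into a fine grid and extending maps cell by cell. For face posets instead of
complexes it is `ChainConnected.of_deletion_link`. Infinitely many vertices are dealt with by
compactness (`PreAbstractSimplicialComplex.isNConnected_of_finite`).
-/

/-! ### Continuous maps into realizations -/

namespace PreAbstractSimplicialComplex

open Set

variable {ι : Type*} {K : PreAbstractSimplicialComplex ι}

namespace Realization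

/-- The barycentric coordinates of a point of a realization. -/
def weight (w : K.Realization) : ι →₀ ℝ := w.1

theorem ext {w w' : K.Realization} (h : ∀ i, w.weight i = w'.weight i) : w = w' :=
  Subtype.ext (Finsupp.ext h)

theorem weight_nonneg (w : K.Realization) (i : ι) : 0 ≤ w.weight i := w.2.1 i

theorem support_mem (w : K.Realization) : w.weight.support ∈ K.faces := w.2.2.2

theorem sum_eq_one (w : K.Realization) {F : Finset ι} (hF : w.weight.support ⊆ F) :
    ∑ i ∈ F, w.weight i = 1 :=
  (Finsupp.sum_of_support_subset _ hF (fun _ a => a) fun _ _ => rfl).symm.trans w.2.2.1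

theorem le_one (w : K.Realization) (i : ι) : w.weight i ≤ 1 := by
  classical
  by_cases hi : i ∈ w.weight.support
  · exact (Finset.single_le_sum (f := fun j => w.weight j) (fun j _ => w.weight_nonneg j) hi).trans
      (w.sum_eq_one subset_rfl).le
  · rw [Finsupp.notMem_support_iff.1 hi]
    exact zero_le_one

end Realization

theorem faceMap_sum (s : K.faces) (x : stdSimplex ℝ s.1) (c : ι → ℝ) :
    ((K.faceMap s x).weight.sum fun i a => c i * a) = ∑ i : s.1, c i * x.1 i := by
  unfold faceMap Realization.weight
  rw [Finsupp.sum_embDomain, Finsupp.sum_fintype _ _ (fun _ => mul_zero _)]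
  rfl

/-- In the weak topology every linear functional of the barycentric coordinates is continuous, even
one with unbounded coefficients. -/
theorem continuous_weightedSum (c : ι → ℝ) :
    Continuous fun w : K.Realization => w.weight.sum fun i a => c i * a := by
  refine continuous_iSup_dom.2 fun s => continuous_coinduced_dom.2 ?_
  have h : ((fun w : K.Realization => w.weight.sum fun i a => c i * a) ∘ K.faceMap s)
      = fun x => ∑ i : s.1, c i * x.1 i := by
    funext x
    exact faceMap_sum s x c
  rw [h]
  exact continuous_finsetSum _ fun i _ =>
    continuous_const.mul ((continuous_apply i).comp continuous_subtype_val)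

theorem continuous_coord (i : ι) : Continuous fun w : K.Realization => w.weight i := by
  classical
  convert continuous_weightedSum (K := K) (fun j => if j = i then 1 else 0) using 2 with w
  simp [Finsupp.sum]

theorem faceMap_eq (w : K.Realization) {s : Finset ι} (hs : s ∈ K.faces)
    (h : w.weight.support ⊆ s) :
    K.faceMap ⟨s, hs⟩ ⟨fun i => w.weight i, fun i => w.weight_nonneg i, by
      rw [Finset.sum_coe_sort s (fun i => w.weight i)]
      exact w.sum_eq_one h⟩ = w := by
  refine Realization.ext fun i => ?_
  unfold faceMap Realization.weight
  by_cases hi : i ∈ s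
  · exact Finsupp.embDomain_apply_self (Function.Embedding.subtype (· ∈ s)) _ ⟨i, hi⟩
  · rw [Finsupp.embDomain_of_notMem_range]
    · exact (Finsupp.notMem_support_iff.1 fun hi' => hi (h hi')).symm
    · rintro ⟨j, rfl⟩
      exact hi j.2

/-- A map into a realization whose values are supported on one finite set of vertices is continuous
if its barycentric coordinates are: its domain is covered by finitely many closed sets, each mapped
into a single closed simplex. -/
theorem continuous_of_coord {Z : Type*} [TopologicalSpace Z] {f : Z → K.Realization}
    (F : Finset ι) (hF : ∀ z, (f z).weight.support ⊆ F)
    (hc : ∀ i, Continuous fun z => (f z).weight i) : Continuous f := by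
  classical
  let J := {s : Finset ι // s ∈ F.powerset ∧ s ∈ K.faces}
  have : Finite J :=
    Finite.of_injective (fun s : J => (⟨s.1, s.2.1⟩ : {s // s ∈ F.powerset}))
      fun a b h => Subtype.ext (congrArg (fun x => x.1) h)
  let A : J → Set Z := fun s => {z | ∀ i, i ∉ s.1 → (f z).weight i = 0}
  refine (locallyFinite_of_finite A).continuous ?_ ?_ ?_
  · refine eq_univ_of_forall fun z => mem_iUnion.2
      ⟨⟨(f z).weight.support, Finset.mem_powerset.2 (hF z), (f z).support_mem⟩, fun i hi => ?_⟩
    exact Finsupp.notMem_support_iff.1 hi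
  · intro s
    simp only [A, ofPred_forall]
    exact isClosed_iInter fun i => isClosed_iInter fun _ => isClosed_eq (hc i) continuous_const
  · intro s
    rw [continuousOn_iff_continuous_domRestrict]
    have hsub : ∀ z : A s, (f z).weight.support ⊆ s.1 := fun z i hi => by
      by_contra h
      exact (Finsupp.mem_support_iff.1 hi) (z.2 i h)
    have heq : (A s).domRestrict f = K.faceMap ⟨s.1, s.2.2⟩ ∘ fun z : A s =>
        (⟨fun i => (f z).weight i, fun i => (f z).weight_nonneg i, by
          rw [Finset.sum_coe_sort s.1 (fun i => (f z).weight i)]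
          exact (f z).sum_eq_one (hsub z)⟩ : stdSimplex ℝ s.1) := by
      funext z
      exact (faceMap_eq (f z) s.2.2 (hsub z)).symm
    rw [heq]
    refine Continuous.comp ?_ ?_
    · exact continuous_iSup_rng (i := (⟨s.1, s.2.2⟩ : K.faces)) continuous_coinduced_rng
    · exact Continuous.subtype_mk (continuous_pi fun i : s.1 => (hc i).comp continuous_subtype_val) _

theorem continuousOn_of_coord {Z : Type*} [TopologicalSpace Z] {f : Z → K.Realization}
    {C : Set Z} (F : Finset ι) (hF : ∀ z ∈ C, (f z).weight.support ⊆ F)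
    (hc : ∀ i, ContinuousOn (fun z => (f z).weight i) C) : ContinuousOn f C := by
  rw [continuousOn_iff_continuous_domRestrict]
  exact continuous_of_coord F (fun z => hF z z.2)
    fun i => continuousOn_iff_continuous_domRestrict.1 (hc i)

theorem _root_.ContinuousOn.coord {Z : Type*} [TopologicalSpace Z] {f : Z → K.Realization}
    {C : Set Z} (hf : ContinuousOn f C) (i : ι) : ContinuousOn (fun z => (f z).weight i) C :=
  (continuous_coord i).comp_continuousOn hf

/-- A compact subset of a realization meets only finitely many open stars of vertices: otherwise
some linear functional of the coordinates with fast growing coefficients is unbounded on it. -/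
theorem exists_finset_support_subset {C : Set K.Realization} (hC : IsCompact C) :
    ∃ F : Finset ι, ∀ w ∈ C, w.weight.support ⊆ F := by
  classical
  let S : Set ι := {i | ∃ w ∈ C, w.weight i ≠ 0}
  by_cases hS : S.Finite
  · exact ⟨hS.toFinset, fun w hw i hi =>
      hS.mem_toFinset.2 ⟨w, hw, Finsupp.mem_support_iff.1 hi⟩⟩
  exfalso
  let e : ℕ ↪ S := Set.Infinite.natEmbedding S hS
  choose p hpC hp using fun n => (e n).2
  let c : ι → ℝ := fun i => if h : ∃ n, (e n : ι) = i then
    (h.choose : ℝ) / (p h.choose).weight (e h.choose) else 0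
  have hce : ∀ n, c (e n) = n / (p n).weight (e n) := fun n => by
    have h : ∃ m, (e m : ι) = e n := ⟨n, rfl⟩
    have h' : h.choose = n := e.injective (Subtype.ext h.choose_spec)
    simp only [c, dif_pos h, h']
  have hc0 : ∀ i, 0 ≤ c i := fun i => by
    simp only [c]
    split_ifs with h
    · exact div_nonneg (Nat.cast_nonneg _) ((p _).weight_nonneg _)
    · exact le_rfl
  obtain ⟨b, hb⟩ := (hC.image (continuous_weightedSum c)).bddAbove
  obtain ⟨n, hn⟩ := exists_nat_gt b
  have h1 : (p n).weight.sum (fun i a => c i * a) ≤ b := hb ⟨p n, hpC n, rfl⟩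
  have h2 : c (e n) * (p n).weight (e n) ≤ (p n).weight.sum fun i a => c i * a :=
    Finset.single_le_sum (f := fun i => c i * (p n).weight i)
      (fun i _ => mul_nonneg (hc0 i) ((p n).weight_nonneg i)) (Finsupp.mem_support_iff.2 (hp n))
  rw [hce, div_mul_cancel₀ _ (hp n)] at h2
  linarith

theorem _root_.ContinuousOn.exists_finset_support {Z : Type*} [TopologicalSpace Z]
    {f : Z → K.Realization} {C : Set Z} (hf : ContinuousOn f C) (hC : IsCompact C) :
    ∃ F : Finset ι, ∀ z ∈ C, (f z).weight.support ⊆ F := by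
  obtain ⟨F, hF⟩ := exists_finset_support_subset (hC.image_of_continuousOn hf)
  exact ⟨F, fun z hz => hF _ ⟨z, hz, rfl⟩⟩

end PreAbstractSimplicialComplex

/-! ### Connectivity tested on cubes -/

section Cube

open Set Metric

/-- The unit ball of the sup norm and the Euclidean unit ball of the same dimension are
homeomorphic, by a homeomorphism of the ambient spaces. -/
theorem exists_homeomorph_ball_sup (J : Type*) [Fintype J] :
    ∃ h : EuclideanSpace ℝ (Fin (Fintype.card J)) ≃ₜ (J → ℝ),
      h '' closedBall 0 1 = closedBall 0 1 ∧ h '' sphere 0 1 = sphere 0 1 := by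
  let E := EuclideanSpace ℝ (Fin (Fintype.card J))
  have hfr : Module.finrank ℝ (J → ℝ) = Module.finrank ℝ E := by simp [E]
  let L : (J → ℝ) ≃L[ℝ] E := ContinuousLinearEquiv.ofFinrankEq hfr
  let Lh : (J → ℝ) ≃ₜ E := L.toHomeomorph
  obtain ⟨e, -, hcl, hfr⟩ := exists_homeomorph_image_interior_closure_frontier_eq_unitBall
    (E := E) (s := L '' closedBall 0 1) ((convex_closedBall _ _).linear_image L.toLinearMap) (by
      change (interior (Lh '' _)).Nonempty
      rw [← Lh.image_interior, interior_closedBall _ one_ne_zero]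
      exact (nonempty_ball.2 one_pos).image _) (by
      exact ((isCompact_closedBall _ _).image L.continuous).isBounded)
  have h1 : e '' (Lh '' closedBall 0 1) = closedBall 0 1 := by
    rw [← hcl]
    exact congrArg _ (((isCompact_closedBall _ _).image L.continuous).isClosed.closure_eq).symm
  have h2 : e '' (Lh '' sphere 0 1) = sphere 0 1 := by
    rw [← hfr]
    change _ = e '' (frontier (Lh '' _))
    rw [← Lh.image_frontier, frontier_closedBall _ one_ne_zero]
  refine ⟨(Lh.trans e).symm, ?_, ?_⟩
  · rw [← h1, ← image_comp, ← image_comp]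
    convert image_id _
    funext x
    exact (Lh.trans e).symm_apply_apply x
  · rw [← h2, ← image_comp, ← image_comp]
    convert image_id _
    funext x
    exact (Lh.trans e).symm_apply_apply x

/-- A map from the boundary of a cube of dimension at most `n + 1` to an `n`-connected space extends
to the cube. -/
theorem IsNConnected.exists_extension_cube {X : Type*} [TopologicalSpace X] {n : ℤ}
    (hX : IsNConnected X n) (J : Type*) [Fintype J] (hJ : (Fintype.card J : ℤ) ≤ n + 1)
    {f : (J → ℝ) → X} (hf : ContinuousOn f (sphere 0 1)) :
    ∃ g : (J → ℝ) → X, ContinuousOn g (closedBall 0 1) ∧ EqOn g f (sphere 0 1) := by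
  obtain ⟨h, hb, hs⟩ := exists_homeomorph_ball_sup J
  have hs' : ∀ x ∈ sphere (0 : EuclideanSpace ℝ (Fin (Fintype.card J))) 1, h x ∈ sphere 0 1 :=
    fun x hx => hs ▸ mem_image_of_mem h hx
  obtain ⟨g, hg⟩ := hX _ hJ ⟨fun x => f (h x), (continuousOn_iff_continuous_domRestrict.1 hf).comp
    (Continuous.subtype_mk (h.continuous.comp continuous_subtype_val) fun x => hs' x x.2)⟩
  have hb' : ∀ x ∈ closedBall (0 : J → ℝ) 1, h.symm x ∈ closedBall 0 1 := fun x hx => by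
    rw [← hb] at hx
    obtain ⟨y, hy, rfl⟩ := hx
    rwa [h.symm_apply_apply]
  have hsb' : ∀ x ∈ sphere (0 : J → ℝ) 1, h.symm x ∈ sphere 0 1 := fun x hx => by
    rw [← hs] at hx
    obtain ⟨y, hy, rfl⟩ := hx
    rwa [h.symm_apply_apply]
  classical
  refine ⟨fun x => if hx : x ∈ closedBall 0 1 then g ⟨h.symm x, hb' x hx⟩ else f x, ?_, ?_⟩
  · rw [continuousOn_iff_continuous_domRestrict]
    have : (closedBall (0 : J → ℝ) 1).domRestrict
        (fun x => if hx : x ∈ closedBall 0 1 then g ⟨h.symm x, hb' x hx⟩ else f x)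
        = fun x : closedBall (0 : J → ℝ) 1 => g ⟨h.symm x, hb' x x.2⟩ := by
      funext x
      exact dif_pos x.2
    rw [this]
    exact g.continuous.comp
      (Continuous.subtype_mk (h.symm.continuous.comp continuous_subtype_val) _)
  · intro x hx
    simp only [dif_pos (sphere_subset_closedBall hx)]
    exact (hg ⟨h.symm x, hsb' x hx⟩).trans (congrArg f (h.apply_symm_apply x))

theorem IsNConnected.nonempty {X : Type*} [TopologicalSpace X] {n : ℤ} (hX : IsNConnected X n)
    (hn : -1 ≤ n) : Nonempty X := by
  obtain ⟨g, -⟩ := hX 0 (by simpa using by linarith) ⟨fun x => by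
    have h := x.2
    rw [mem_sphere_zero_iff_norm, Subsingleton.elim x.1 0, norm_zero] at h
    exact absurd h zero_ne_one, by
      refine continuous_iff_continuousAt.2 fun x => ?_
      have h := x.2
      rw [mem_sphere_zero_iff_norm, Subsingleton.elim x.1 0, norm_zero] at h
      exact absurd h zero_ne_one⟩
  exact ⟨g ⟨0, by simp⟩⟩

/-- Connectivity may be tested on cubes. Since total functions are used, the case of the empty
boundary of the point has to be stated separately. -/
theorem IsNConnected.of_cube {X : Type*} [TopologicalSpace X] {n : ℤ}
    (hne : -1 ≤ n → Nonempty X)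
    (h : ∀ k : ℕ, (k : ℤ) ≤ n + 1 → ∀ f : (Fin k → ℝ) → X, ContinuousOn f (sphere 0 1) →
      ∃ g : (Fin k → ℝ) → X, ContinuousOn g (closedBall 0 1) ∧ EqOn g f (sphere 0 1)) :
    IsNConnected X n := by
  intro k hk f
  obtain ⟨x₀⟩ := hne (by linarith [Int.natCast_nonneg k])
  obtain ⟨e, he⟩ : ∃ e : EuclideanSpace ℝ (Fin k) ≃ₜ (Fin k → ℝ),
      e '' closedBall 0 1 = closedBall 0 1 ∧ e '' sphere 0 1 = sphere 0 1 := by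
    have := exists_homeomorph_ball_sup (Fin k)
    rwa [Fintype.card_fin] at this
  obtain ⟨hb, hs⟩ := he
  have hsb' : ∀ x ∈ sphere (0 : Fin k → ℝ) 1, e.symm x ∈ sphere 0 1 := fun x hx => by
    rw [← hs] at hx
    obtain ⟨y, hy, rfl⟩ := hx
    rwa [e.symm_apply_apply]
  classical
  obtain ⟨g, hgc, hg⟩ := h k hk
    (fun x => if hx : x ∈ sphere 0 1 then f ⟨e.symm x, hsb' x hx⟩ else x₀) (by
      rw [continuousOn_iff_continuous_domRestrict]
      have : (sphere (0 : Fin k → ℝ) 1).domRestrict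
          (fun x => if hx : x ∈ sphere 0 1 then f ⟨e.symm x, hsb' x hx⟩ else x₀)
          = fun x : sphere (0 : Fin k → ℝ) 1 => f ⟨e.symm x, hsb' x x.2⟩ := by
        funext x
        exact dif_pos x.2
      rw [this]
      exact f.continuous.comp
        (Continuous.subtype_mk (e.symm.continuous.comp continuous_subtype_val) _))
  refine ⟨⟨fun x => g (e x), (continuousOn_iff_continuous_domRestrict.1 hgc).comp
    (Continuous.subtype_mk (e.continuous.comp continuous_subtype_val)
      fun x => hb ▸ mem_image_of_mem e x.2)⟩, fun x => ?_⟩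
  have hx : e x.1 ∈ sphere (0 : Fin k → ℝ) 1 := hs ▸ mem_image_of_mem e x.2
  have h1 := hg hx
  simp only [dif_pos hx] at h1
  refine h1.trans ?_
  congr 1
  exact Subtype.ext (e.symm_apply_apply x.1)

theorem IsNConnected.of_le_neg_two {X : Type*} [TopologicalSpace X] {n : ℤ} (hn : n ≤ -2) :
    IsNConnected X n := fun k hk => absurd hk (by have := Int.natCast_nonneg k; linarith)

/-- If a map on the unit sphere is homotopic to one that extends to the ball, it extends itself: put
the homotopy on the outer half of the ball. -/
theorem exists_extension_of_homotopy {X E : Type*} [TopologicalSpace X] [NormedAddCommGroup E]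
    [NormedSpace ℝ E] {f : E → X} {g : E → X} (hg : ContinuousOn g (closedBall 0 1))
    (H : ℝ × E → X) (hH : ContinuousOn H (Icc 0 1 ×ˢ sphere 0 1))
    (h0 : ∀ x ∈ sphere (0 : E) 1, H (0, x) = g x) (h1 : ∀ x ∈ sphere (0 : E) 1, H (1, x) = f x) :
    ∃ G : E → X, ContinuousOn G (closedBall 0 1) ∧ EqOn G f (sphere 0 1) := by
  classical
  let A : Set E := {x | ‖x‖ ≤ 1 / 2}
  let B : Set E := {x | 1 / 2 ≤ ‖x‖ ∧ ‖x‖ ≤ 1}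
  let G : E → X := fun x => if ‖x‖ ≤ 1 / 2 then g ((2 : ℝ) • x) else H (2 * ‖x‖ - 1, ‖x‖⁻¹ • x)
  have hsph : ∀ x : E, 1 / 2 ≤ ‖x‖ → ‖x‖⁻¹ • x ∈ sphere (0 : E) 1 := fun x hx => by
    have : ‖x‖ ≠ 0 := by linarith
    simp [norm_smul, this]
  have hGB : ∀ x, 1 / 2 ≤ ‖x‖ → G x = H (2 * ‖x‖ - 1, ‖x‖⁻¹ • x) := fun x hx => by
    by_cases hx' : ‖x‖ ≤ 1 / 2
    · have hxx : ‖x‖ = 1 / 2 := le_antisymm hx' hx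
      have h := hsph x hx
      simp only [G, if_pos hx', hxx]
      rw [hxx] at h
      norm_num at h ⊢
      exact (h0 _ (by simpa using h)).symm
    · simp only [G, if_neg hx']
  refine ⟨G, ?_, ?_⟩
  · have hA : ContinuousOn G A := by
      have : ContinuousOn (fun x : E => g ((2 : ℝ) • x)) A :=
        hg.comp (by fun_prop) fun x hx => by
          have hx : ‖x‖ ≤ 1 / 2 := hx
          rw [mem_closedBall_zero_iff, norm_smul, Real.norm_ofNat]
          linarith
      exact this.congr fun x hx => if_pos hx
    have hB : ContinuousOn G B := by
      have : ContinuousOn (fun x : E => H (2 * ‖x‖ - 1, ‖x‖⁻¹ • x)) B := by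
        refine hH.comp ?_ fun x hx => ⟨⟨?_, ?_⟩, hsph x hx.1⟩
        · refine ContinuousOn.prodMk (by fun_prop) (ContinuousOn.smul ?_ continuousOn_id)
          exact continuous_norm.continuousOn.inv₀ fun x hx => by linarith [hx.1]
        · change 0 ≤ 2 * ‖x‖ - 1
          linarith [hx.1]
        · change 2 * ‖x‖ - 1 ≤ 1
          linarith [hx.2]
      exact this.congr fun x hx => hGB x hx.1
    refine (hA.union_of_isClosed hB ?_ ?_).mono fun x hx => ?_
    · exact isClosed_le continuous_norm continuous_const
    · exact (isClosed_le continuous_const continuous_norm).inter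
        (isClosed_le continuous_norm continuous_const)
    · rw [mem_closedBall_zero_iff] at hx
      rcases le_total ‖x‖ (1 / 2) with h | h
      · exact Or.inl h
      · exact Or.inr ⟨h, hx⟩
  · intro x hx
    have hx' := mem_sphere_zero_iff_norm.1 hx
    rw [hGB x (by rw [hx']; norm_num), hx', ← h1 x hx]
    norm_num

end Cube

/-! ### Extending maps over the cells of a cubical grid -/

section Grid

open Set Metric

variable {κ : Type*}

/-- The box with corners `c.fst / M` and `c.snd / M`. The cells of the cubical grid of mesh `1 / M`
are the boxes for which `c.snd ≤ c.fst + 1`. -/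
def gridBox (M : ℝ) (c : NonemptyInterval (κ → ℤ)) : Set (κ → ℝ) :=
  {x | ∀ i, (c.fst i : ℝ) ≤ M * x i ∧ M * x i ≤ c.snd i}

/-- The smallest cell of the grid of mesh `1 / M` that contains `x`. -/
noncomputable def gridCarrier (M : ℝ) (x : κ → ℝ) : NonemptyInterval (κ → ℤ) :=
  ⟨⟨fun i => ⌊M * x i⌋, fun i => ⌈M * x i⌉⟩, fun _ => Int.floor_le_ceil _⟩

theorem mem_gridBox {M : ℝ} {c : NonemptyInterval (κ → ℤ)} {x : κ → ℝ} :
    x ∈ gridBox M c ↔ gridCarrier M x ≤ c := by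
  constructor
  · exact fun h => ⟨fun i => Int.le_floor.2 (h i).1, fun i => Int.ceil_le.2 (h i).2⟩
  · exact fun h i => ⟨Int.le_floor.1 (h.1 i), Int.ceil_le.1 (h.2 i)⟩

theorem mem_gridBox_gridCarrier (M : ℝ) (x : κ → ℝ) : x ∈ gridBox M (gridCarrier M x) :=
  mem_gridBox.2 le_rfl

theorem isClosed_gridBox (M : ℝ) (c : NonemptyInterval (κ → ℤ)) : IsClosed (gridBox M c) := by
  simp only [gridBox, ofPred_forall, ofPred_and]
  exact isClosed_iInter fun i => (isClosed_le continuous_const (by fun_prop)).inter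
    (isClosed_le (by fun_prop) continuous_const)

theorem isClosed_gridCarrier_mem {M : ℝ} {B : Set (NonemptyInterval (κ → ℤ))} (hBf : B.Finite)
    (hB : IsLowerSet B) : IsClosed {x : κ → ℝ | gridCarrier M x ∈ B} := by
  have : {x : κ → ℝ | gridCarrier M x ∈ B} = ⋃ b ∈ B, gridBox M b := by
    ext x
    simp only [mem_ofPred_eq, mem_iUnion]
    exact ⟨fun h => ⟨_, h, mem_gridBox_gridCarrier M x⟩,
      fun ⟨b, hb, hx⟩ => hB (mem_gridBox.1 hx) hb⟩
  rw [this]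
  exact hBf.isClosed_biUnion fun b _ => isClosed_gridBox M b

/-- A map to an `n`-connected space extends from the boundary of a grid cell of dimension at most
`n + 1` to the cell. The boundary consists of the points with a smaller carrier. -/
theorem IsNConnected.exists_extension_gridBox [Fintype κ] {Z : Type*} [TopologicalSpace Z] {n : ℤ}
    (hZ : IsNConnected Z n) {M : ℝ} (hM : 0 < M) {c : NonemptyInterval (κ → ℤ)}
    (hc : c.snd ≤ c.fst + 1)
    (hdim : (Fintype.card {i // c.fst i < c.snd i} : ℤ) ≤ n + 1) {g : (κ → ℝ) → Z}
    (hg : ContinuousOn g {x | gridCarrier M x < c}) :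
    ∃ G : (κ → ℝ) → Z, ContinuousOn G (gridBox M c) ∧ EqOn G g {x | gridCarrier M x < c} := by
  classical
  let J := {i // c.fst i < c.snd i}
  have hJ : ∀ i, c.fst i < c.snd i → c.snd i = c.fst i + 1 := fun i hi =>
    le_antisymm (hc i) hi
  have hJ' : ∀ i, ¬ c.fst i < c.snd i → c.snd i = c.fst i := fun i hi =>
    le_antisymm (not_lt.1 hi) (c.fst_le_snd i)
  -- `ψ` maps the cube `[-1, 1]^J` onto the cell, and `φ` is its inverse.
  let ψ : (J → ℝ) → (κ → ℝ) := fun y i =>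
    (c.fst i + if h : c.fst i < c.snd i then (y ⟨i, h⟩ + 1) / 2 else 0) / M
  let φ : (κ → ℝ) → (J → ℝ) := fun x i => 2 * (M * x i - c.fst i) - 1
  have hψc : Continuous ψ := continuous_pi fun i => by
    by_cases h : c.fst i < c.snd i
    · simp only [ψ, dif_pos h]
      fun_prop
    · simp only [ψ, dif_neg h]
      fun_prop
  have hφc : Continuous φ := by fun_prop
  have hψφ : ∀ x ∈ gridBox M c, ψ (φ x) = x := fun x hx => by
    funext i
    by_cases h : c.fst i < c.snd i
    · simp only [ψ, φ, dif_pos h]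
      field_simp
      ring
    · have h1 := hx i
      rw [hJ' i h] at h1
      simp only [ψ, dif_neg h]
      rw [add_zero, le_antisymm h1.1 h1.2]
      field_simp
  have hφb : ∀ x ∈ gridBox M c, φ x ∈ closedBall 0 1 := fun x hx => by
    rw [mem_closedBall_zero_iff, pi_norm_le_iff_of_nonneg zero_le_one]
    intro i
    have h1 := hx i
    rw [hJ i i.2] at h1
    push_cast at h1
    rw [Real.norm_eq_abs, abs_le]
    constructor <;> simp only [φ] <;> linarith [h1.1, h1.2]
  have hφs : ∀ x, gridCarrier M x < c → φ x ∈ sphere 0 1 := fun x hx => by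
    have hxc := mem_gridBox.2 hx.le
    rw [mem_sphere_zero_iff_norm]
    refine le_antisymm (mem_closedBall_zero_iff.1 (hφb x hxc)) (not_lt.1 fun hlt => hx.ne ?_)
    rw [pi_norm_lt_iff one_pos] at hlt
    have key : ∀ i, ⌊M * x i⌋ = c.fst i ∧ ⌈M * x i⌉ = c.snd i := fun i => by
      by_cases h : c.fst i < c.snd i
      · have h1 := hlt ⟨i, h⟩
        rw [Real.norm_eq_abs, abs_lt] at h1
        simp only [φ] at h1
        constructor
        · rw [Int.floor_eq_iff]
          constructor <;> linarith
        · rw [Int.ceil_eq_iff, hJ i h]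
          push_cast
          constructor <;> linarith
      · have h1 := hxc i
        rw [hJ' i h] at h1 ⊢
        rw [le_antisymm h1.2 h1.1, Int.floor_intCast, Int.ceil_intCast]
        exact ⟨rfl, rfl⟩
    exact NonemptyInterval.ext (Prod.ext (funext fun i => (key i).1) (funext fun i => (key i).2))
  have hψs : ∀ y ∈ sphere (0 : J → ℝ) 1, gridCarrier M (ψ y) < c := fun y hy => by
    have hy1 := mem_sphere_zero_iff_norm.1 hy
    have hyi : ∀ i, |y i| ≤ 1 := fun i => hy1 ▸ norm_le_pi_norm y i
    have hMψ : ∀ i, M * ψ y i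
        = c.fst i + if h : c.fst i < c.snd i then (y ⟨i, h⟩ + 1) / 2 else 0 := fun i =>
      mul_div_cancel₀ _ hM.ne'
    refine lt_of_le_of_ne (mem_gridBox.1 fun i => ?_) fun heq => ?_
    · rw [hMψ]
      by_cases h : c.fst i < c.snd i
      · have := abs_le.1 (hyi ⟨i, h⟩)
        rw [dif_pos h, hJ i h]
        push_cast
        constructor <;> linarith
      · rw [dif_neg h, hJ' i h, add_zero]
        exact ⟨le_rfl, le_rfl⟩
    · obtain ⟨i, hi⟩ : ∃ i, 1 ≤ |y i| := by
        by_contra! hlt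
        exact hy1.not_lt ((pi_norm_lt_iff one_pos).2 hlt)
      have h1 : ⌊M * ψ y i⌋ = c.fst i := congrFun (congrArg (fun c => c.fst) heq) i.1
      have h2 : ⌈M * ψ y i⌉ = c.snd i := congrFun (congrArg (fun c => c.snd) heq) i.1
      have h3 := hMψ i
      rw [dif_pos i.2] at h3
      have h4 := i.2
      rcases abs_choice (y i) with h | h
      · have : M * ψ y i = ((c.fst i + 1 : ℤ) : ℝ) := by
          rw [h3, show y ⟨i, i.2⟩ = 1 from le_antisymm ((abs_le.1 (hyi i)).2) (h ▸ hi)]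
          push_cast
          norm_num
        rw [this, Int.floor_intCast] at h1
        lia
      · have : M * ψ y i = ((c.fst i : ℤ) : ℝ) := by
          rw [h3, show y ⟨i, i.2⟩ = -1 from
            le_antisymm (by have := h ▸ hi; linarith) ((abs_le.1 (hyi i)).1)]
          norm_num
        rw [this, Int.ceil_intCast] at h2
        lia
  obtain ⟨G, hGc, hG⟩ := hZ.exists_extension_cube J hdim (f := g ∘ ψ)
    (hg.comp hψc.continuousOn hψs)
  refine ⟨G ∘ φ, hGc.comp hφc.continuousOn hφb, fun x hx => ?_⟩
  exact (hG (hφs x hx)).trans (congrArg g (hψφ x (mem_gridBox.2 (le_of_lt hx))))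

/-- A map to an `n`-connected space extends from a subcomplex `A₀` of a finite grid complex `A` to
`A` if all other cells have dimension at most `n + 1`. -/
theorem IsNConnected.exists_extension_grid [Fintype κ] {Z : Type*} [TopologicalSpace Z] {n : ℤ}
    (hZ : IsNConnected Z n) {M : ℝ} (hM : 0 < M) {A₀ : Set (NonemptyInterval (κ → ℤ))}
    (hA₀ : IsLowerSet A₀) {g : (κ → ℝ) → Z} (hg : ContinuousOn g {x | gridCarrier M x ∈ A₀})
    (A : Finset (NonemptyInterval (κ → ℤ))) (hA : IsLowerSet (A : Set (NonemptyInterval (κ → ℤ))))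
    (hAA : A₀ ⊆ A) (hc : ∀ c ∈ A, c.snd ≤ c.fst + 1)
    (hdim : ∀ c ∈ A, (Fintype.card {i // c.fst i < c.snd i} : ℤ) ≤ n + 1) :
    ∃ G : (κ → ℝ) → Z, ContinuousOn G {x | gridCarrier M x ∈ A} ∧
      EqOn G g {x | gridCarrier M x ∈ A₀} := by
  classical
  induction A using Finset.strongInduction with
  | H A ih =>
  by_cases hAA' : (A : Set _) ⊆ A₀
  · exact ⟨g, hg.mono fun x hx => hAA' hx, fun x _ => rfl⟩
  obtain ⟨c₀, hc₀, hc₀'⟩ := not_subset.1 hAA'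
  obtain ⟨c, hcm⟩ := Finset.exists_maximal (s := A.filter (· ∉ A₀))
    ⟨c₀, Finset.mem_filter.2 ⟨hc₀, hc₀'⟩⟩
  obtain ⟨hcA, hcA₀⟩ := Finset.mem_filter.1 hcm.1
  have hmax : ∀ c' ∈ A, c ≤ c' → c' = c := fun c' hc' hle =>
    le_antisymm (hcm.2 (Finset.mem_filter.2 ⟨hc', fun h => hcA₀ (hA₀ hle h)⟩) hle) hle
  obtain ⟨G, hGc, hG⟩ := ih (A.erase c) (Finset.erase_ssubset hcA) (fun a b hba ha => by
      have ha' := Finset.mem_erase.1 ha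
      refine Finset.mem_erase.2 ⟨fun h => ha'.1 (hmax a ha'.2 (h ▸ hba)), hA hba ha'.2⟩)
    (fun a ha => Finset.mem_erase.2 ⟨fun h => hcA₀ (h ▸ ha), hAA ha⟩)
    (fun a ha => hc a (Finset.mem_of_mem_erase ha))
    (fun a ha => hdim a (Finset.mem_of_mem_erase ha))
  have hbd : ∀ x, gridCarrier M x < c → gridCarrier M x ∈ A.erase c := fun x hx =>
    Finset.mem_erase.2 ⟨hx.ne, hA hx.le hcA⟩
  obtain ⟨G', hGc', hG'⟩ := hZ.exists_extension_gridBox hM (hc c hcA) (hdim c hcA)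
    (hGc.mono fun x hx => hbd x hx)
  let Φ : (κ → ℝ) → Z := fun x => if gridCarrier M x = c then G' x else G x
  have h1 : EqOn Φ G {x | gridCarrier M x ∈ A.erase c} := fun x hx =>
    if_neg (Finset.mem_erase.1 hx).1
  have h2 : EqOn Φ G' (gridBox M c) := fun x hx => by
    by_cases h : gridCarrier M x = c
    · exact if_pos h
    · exact (if_neg h).trans (hG' (lt_of_le_of_ne (mem_gridBox.1 hx) h)).symm
  refine ⟨Φ, ?_, fun x hx => (h1 (Finset.mem_erase.2 ⟨fun h => hcA₀ (h ▸ hx), hAA hx⟩)).trans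
    (hG hx)⟩
  refine ((hGc.congr h1).union_of_isClosed (hGc'.congr h2) (isClosed_gridCarrier_mem (Finset.finite_toSet _) ?_)
    (isClosed_gridBox M c)).mono fun x hx => ?_
  · intro a b hba ha
    have ha' := Finset.mem_erase.1 ha
    exact Finset.mem_erase.2 ⟨fun h => ha'.1 (hmax a ha'.2 (h ▸ hba)), hA hba ha'.2⟩
  · by_cases h : gridCarrier M x = c
    · exact Or.inr (mem_gridBox.2 h.le)
    · exact Or.inl (Finset.mem_erase.2 ⟨h, hx⟩)

end Grid

/-! ### Connectivity of realizations: cones, retracts, finite subcomplexes -/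

namespace PreAbstractSimplicialComplex

open Set Metric

variable {ι : Type*} {K : PreAbstractSimplicialComplex ι}

theorem mem_faces_of_subset {s t : Finset ι} (hs : s ∈ K.faces) (hts : t ⊆ s)
    (ht : t.Nonempty) : t ∈ K.faces :=
  (K.isRelLowerSet_faces hs).2 hts ht

theorem nonempty_of_mem_faces {s : Finset ι} (hs : s ∈ K.faces) : s.Nonempty :=
  (K.isRelLowerSet_faces hs).1

theorem Realization.weight_eq_zero (w : K.Realization) {s : Finset ι}
    (hs : w.weight.support ⊆ s) {i : ι} (hi : i ∉ s) : w.weight i = 0 :=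
  Finsupp.notMem_support_iff.1 fun h => hi (hs h)

theorem Realization.support_subset (w : K.Realization) {s : Finset ι}
    (hs : ∀ i, i ∉ s → w.weight i = 0) : w.weight.support ⊆ s := fun i hi => by
  by_contra h
  exact Finsupp.mem_support_iff.1 hi (hs i h)

theorem nonempty_realization {s : Finset ι} (hs : s ∈ K.faces) : Nonempty K.Realization := by
  obtain ⟨i, hi⟩ := nonempty_of_mem_faces hs
  refine ⟨⟨Finsupp.single i 1, fun j => ?_, by simp, ?_⟩⟩
  · exact (Finsupp.single_nonneg.2 zero_le_one : (0 : ι →₀ ℝ) ≤ Finsupp.single i 1) j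
  · rw [Finsupp.support_single _ (one_ne_zero : (1 : ℝ) ≠ 0)]
    exact mem_faces_of_subset hs (Finset.singleton_subset_iff.2 hi) (Finset.singleton_nonempty i)

/-- A continuous map to a realization may be given by continuous families of barycentric
coordinates, with all supports in one finite set of vertices. -/
theorem exists_map_of_weight {Z : Type*} [TopologicalSpace Z] (hK : Nonempty K.Realization)
    (w : Z → ι → ℝ) (C : Set Z) (F : Finset ι) (h0 : ∀ z ∈ C, ∀ i, 0 ≤ w z i)
    (h1 : ∀ z ∈ C, ∑ i ∈ F, w z i = 1) (hs : ∀ z ∈ C, ∃ s ∈ K.faces, ∀ i, i ∉ s → w z i = 0)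
    (hF : ∀ z ∈ C, ∀ i, i ∉ F → w z i = 0) (hc : ∀ i, ContinuousOn (fun z => w z i) C) :
    ∃ f : Z → K.Realization, ContinuousOn f C ∧ ∀ z ∈ C, ∀ i, (f z).weight i = w z i := by
  classical
  have key : ∀ z ∈ C, ∃ p : K.Realization, ∀ i, p.weight i = w z i := fun z hz => by
    obtain ⟨s, hsK, hs⟩ := hs z hz
    let a : ι →₀ ℝ := Finsupp.onFinset F (w z) fun i hi => by
      by_contra h
      exact hi (hF z hz i h)
    have hsum : (a.sum fun _ x => x) = 1 := by
      rw [Finsupp.sum_of_support_subset a Finsupp.support_onFinset_subset _ fun _ _ => rfl]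
      exact h1 z hz
    refine ⟨⟨a, h0 z hz, hsum, mem_faces_of_subset hsK (fun i hi => ?_) ?_⟩, fun i => rfl⟩
    · by_contra h
      exact Finsupp.mem_support_iff.1 hi (hs i h)
    · rw [Finset.nonempty_iff_ne_empty, Ne, Finsupp.support_eq_empty]
      intro h
      rw [h, Finsupp.sum_zero_index] at hsum
      exact zero_ne_one hsum
  choose! f hf using key
  refine ⟨fun z => if z ∈ C then f z else hK.some, ?_, fun z hz i => ?_⟩
  · refine continuousOn_of_coord F (fun z hz => ?_) fun i => (hc i).congr fun z hz => ?_
    · exact Realization.support_subset _ fun i hi => by rw [if_pos hz, hf z hz, hF z hz i hi]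
    · simp only [if_pos hz, hf z hz]
  · simp only [if_pos hz, hf z hz]

/-- The straight line homotopy between two maps such that corresponding values lie in a common
simplex, in the form needed for extension problems. -/
theorem exists_extension_of_contiguous {E : Type*} [NormedAddCommGroup E] [NormedSpace ℝ E]
    [ProperSpace E] {f g : E → K.Realization} (hf : ContinuousOn f (sphere 0 1))
    (hg : ContinuousOn g (closedBall 0 1))
    (hfg : ∀ x ∈ sphere (0 : E) 1, ∃ s ∈ K.faces,
      (f x).weight.support ⊆ s ∧ (g x).weight.support ⊆ s) :
    ∃ G : E → K.Realization, ContinuousOn G (closedBall 0 1) ∧ EqOn G f (sphere 0 1) := by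
  classical
  have hg' := hg.mono sphere_subset_closedBall
  obtain ⟨F₁, hF₁⟩ := hf.exists_finset_support (isCompact_sphere 0 1)
  obtain ⟨F₂, hF₂⟩ := hg'.exists_finset_support (isCompact_sphere 0 1)
  have hF₁' : ∀ x ∈ sphere (0 : E) 1, (f x).weight.support ⊆ F₁ ∪ F₂ := fun x hx =>
    (hF₁ x hx).trans Finset.subset_union_left
  have hF₂' : ∀ x ∈ sphere (0 : E) 1, (g x).weight.support ⊆ F₁ ∪ F₂ := fun x hx =>
    (hF₂ x hx).trans Finset.subset_union_right
  have hsnd : MapsTo Prod.snd (Icc (0 : ℝ) 1 ×ˢ sphere (0 : E) 1) (sphere 0 1) := fun p hp => hp.2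
  obtain ⟨H, hHc, hH⟩ := exists_map_of_weight (K := K) ⟨f 0⟩
    (fun p : ℝ × E => fun i => (1 - p.1) * (g p.2).weight i + p.1 * (f p.2).weight i)
    (Icc 0 1 ×ˢ sphere 0 1) (F₁ ∪ F₂)
    (fun p hp i => add_nonneg
      (mul_nonneg (by linarith [hp.1.2]) (Realization.weight_nonneg _ _))
      (mul_nonneg hp.1.1 (Realization.weight_nonneg _ _)))
    (fun p hp => by
      rw [Finset.sum_add_distrib, ← Finset.mul_sum, ← Finset.mul_sum,
        Realization.sum_eq_one _ (hF₁' _ hp.2), Realization.sum_eq_one _ (hF₂' _ hp.2)]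
      ring)
    (fun p hp => by
      obtain ⟨s, hs, h1, h2⟩ := hfg p.2 hp.2
      exact ⟨s, hs, fun i hi => by
        rw [Realization.weight_eq_zero _ h1 hi, Realization.weight_eq_zero _ h2 hi]; ring⟩)
    (fun p hp i hi => by
      rw [Realization.weight_eq_zero _ (hF₁' _ hp.2) hi,
        Realization.weight_eq_zero _ (hF₂' _ hp.2) hi]; ring)
    (fun i => ((continuousOn_const.sub continuousOn_fst).mul
        ((hg'.coord i).comp continuousOn_snd hsnd)).add
      (continuousOn_fst.mul ((hf.coord i).comp continuousOn_snd hsnd)))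
  refine exists_extension_of_homotopy hg H hHc (fun x hx => ?_) fun x hx => ?_
  · exact Realization.ext fun i => (hH (0, x) ⟨by simp, hx⟩ i).trans (by simp)
  · exact Realization.ext fun i => (hH (1, x) ⟨by simp, hx⟩ i).trans (by simp)

/-- A cone is `n`-connected for all `n`. -/
theorem isNConnected_of_cone [DecidableEq ι] {v : ι} (hv : {v} ∈ K.faces)
    (h : ∀ s ∈ K.faces, insert v s ∈ K.faces) (n : ℤ) : IsNConnected K.Realization n := by
  have hne := nonempty_realization hv
  refine IsNConnected.of_cube (fun _ => hne) fun k _ f hf => ?_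
  obtain ⟨g, hgc, hg⟩ := exists_map_of_weight (Z := Fin k → ℝ) hne
    (fun _ i => if i = v then 1 else 0) univ {v} (fun _ _ i => by split_ifs <;> norm_num)
    (fun _ _ => by simp) (fun _ _ => ⟨{v}, hv, fun i hi => if_neg (by simpa using hi)⟩)
    (fun _ _ i hi => if_neg (by simpa using hi)) fun i => continuousOn_const
  refine exists_extension_of_contiguous hf (hgc.mono (subset_univ _)) fun x _ =>
    ⟨_, h _ (f x).support_mem, Finset.subset_insert _ _, ?_⟩
  refine Realization.support_subset _ fun i hi => ?_
  rw [hg x (mem_univ x)]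
  exact if_neg fun hiv : i = v => hi (hiv ▸ Finset.mem_insert_self _ _)

/-- The map of realizations induced by a simplicial map. -/
theorem exists_map_mapDomain {ι' Z : Type*} [DecidableEq ι'] [TopologicalSpace Z]
    {K' : PreAbstractSimplicialComplex ι'} (hK' : Nonempty K'.Realization) (e : ι → ι')
    (he : ∀ s ∈ K.faces, s.image e ∈ K'.faces) {f : Z → K.Realization} {C : Set Z}
    (hC : IsCompact C) (hf : ContinuousOn f C) :
    ∃ g : Z → K'.Realization, ContinuousOn g C ∧
      ∀ z ∈ C, (g z).weight = Finsupp.mapDomain e (f z).weight := by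
  obtain ⟨F, hF⟩ := hf.exists_finset_support hC
  have hmap : ∀ z, ∀ G : Finset ι, (f z).weight.support ⊆ G → ∀ j,
      Finsupp.mapDomain e (f z).weight j = ∑ i ∈ G, if e i = j then (f z).weight i else 0 := by
    intro z G hz j
    rw [Finsupp.mapDomain, Finsupp.sum_apply,
      Finsupp.sum_of_support_subset _ hz _ fun _ _ => by simp]
    exact Finset.sum_congr rfl fun i _ => Finsupp.single_apply
  have hzero : ∀ z, ∀ G : Finset ι, (f z).weight.support ⊆ G → ∀ j, j ∉ G.image e →
      Finsupp.mapDomain e (f z).weight j = 0 := by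
    intro z G hz j hj
    rw [hmap z G hz]
    exact Finset.sum_eq_zero fun i hi =>
      if_neg fun h => hj (Finset.mem_image.2 ⟨i, hi, h⟩)
  obtain ⟨g, hgc, hg⟩ := exists_map_of_weight hK'
    (fun z j => Finsupp.mapDomain e (f z).weight j) C (F.image e)
    (fun z _ j => by
      rw [hmap z _ subset_rfl]
      exact Finset.sum_nonneg fun i _ => by
        split_ifs
        exacts [Realization.weight_nonneg _ _, le_rfl])
    (fun z hz => by
      rw [Finset.sum_congr rfl fun j _ => hmap z F (hF z hz) j, Finset.sum_comm,
        ← (f z).sum_eq_one (hF z hz)]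
      exact Finset.sum_congr rfl fun i hi => by
        rw [Finset.sum_ite_eq, if_pos (Finset.mem_image_of_mem e hi)])
    (fun z _ => ⟨_, he _ (f z).support_mem, hzero z _ subset_rfl⟩)
    (fun z hz => hzero z F (hF z hz))
    (fun j => by
      refine ContinuousOn.congr (f := fun z => ∑ i ∈ F, if e i = j then (f z).weight i else 0) ?_
        fun z hz => hmap z F (hF z hz) j
      refine continuousOn_finsetSum _ fun i _ => ?_
      split_ifs
      exacts [hf.coord i, continuousOn_const])
  exact ⟨g, hgc, fun z hz => Finsupp.ext (hg z hz)⟩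

/-- Connectivity passes to simplicial retracts. -/
theorem isNConnected_of_retract {ι' : Type*} [DecidableEq ι] [DecidableEq ι']
    {K' : PreAbstractSimplicialComplex ι'} {n : ℤ} (hK' : IsNConnected K'.Realization n)
    (e : ι → ι') (e' : ι' → ι) (he : ∀ s ∈ K.faces, s.image e ∈ K'.faces)
    (he' : ∀ s ∈ K'.faces, s.image e' ∈ K.faces) (hee : ∀ s ∈ K.faces, ∀ i ∈ s, e' (e i) = i) :
    IsNConnected K.Realization n := by
  by_cases hn : n ≤ -2
  · exact IsNConnected.of_le_neg_two hn
  have hne' := hK'.nonempty (by lia)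
  have hne := nonempty_realization (he' _ hne'.some.support_mem)
  refine IsNConnected.of_cube (fun _ => hne) fun k hk f hf => ?_
  obtain ⟨g, hgc, hg⟩ := exists_map_mapDomain hne' e he (isCompact_sphere 0 1) hf
  obtain ⟨G, hGc, hG⟩ := hK'.exists_extension_cube (Fin k) (by simpa using hk) hgc
  obtain ⟨G', hGc', hG'⟩ := exists_map_mapDomain hne e' he' (isCompact_closedBall 0 1) hGc
  refine ⟨G', hGc', fun x hx => Realization.ext fun i => ?_⟩
  rw [hG' x (sphere_subset_closedBall hx), hG hx, hg x hx, ← Finsupp.mapDomain_comp,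
    Finsupp.mapDomain_congr (f := e' ∘ e) (g := id)
      fun i hi => hee _ (f x).support_mem i hi,
    Finsupp.mapDomain_id]

theorem exists_map_of_faces {Z : Type*} [TopologicalSpace Z]
    {K' : PreAbstractSimplicialComplex ι} (hK' : Nonempty K'.Realization)
    {f : Z → K.Realization} {C : Set Z} (hC : IsCompact C) (hf : ContinuousOn f C)
    (h : ∀ z ∈ C, (f z).weight.support ∈ K'.faces) :
    ∃ g : Z → K'.Realization, ContinuousOn g C ∧ ∀ z ∈ C, ∀ i, (g z).weight i = (f z).weight i := by
  obtain ⟨F, hF⟩ := hf.exists_finset_support hC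
  exact exists_map_of_weight hK' _ C F (fun z _ i => (f z).weight_nonneg i)
    (fun z hz => (f z).sum_eq_one (hF z hz))
    (fun z hz => ⟨_, h z hz, fun i hi => Finsupp.notMem_support_iff.1 hi⟩)
    (fun z hz i hi => (f z).weight_eq_zero (hF z hz) hi) fun i => hf.coord i

/-- A complex is `n`-connected if every finite set of vertices is contained, with all its faces, in
an `n`-connected subcomplex. -/
theorem isNConnected_of_finite {n : ℤ}
    (h : ∀ F : Finset ι, ∃ K' : PreAbstractSimplicialComplex ι, K'.faces ⊆ K.faces ∧
      (∀ s ∈ K.faces, s ⊆ F → s ∈ K'.faces) ∧ IsNConnected K'.Realization n) :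
    IsNConnected K.Realization n := by
  by_cases hn : n ≤ -2
  · exact IsNConnected.of_le_neg_two hn
  have hne : Nonempty K.Realization := by
    obtain ⟨K', hKK', -, hK'⟩ := h ∅
    exact nonempty_realization (hKK' (hK'.nonempty (by lia)).some.support_mem)
  refine IsNConnected.of_cube (fun _ => hne) fun k hk f hf => ?_
  obtain ⟨F, hF⟩ := hf.exists_finset_support (isCompact_sphere 0 1)
  obtain ⟨K', hKK', hFK', hK'⟩ := h F
  obtain ⟨g, hgc, hg⟩ := exists_map_of_faces (hK'.nonempty (by lia)) (isCompact_sphere 0 1) hf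
    fun z hz => hFK' _ (f z).support_mem (hF z hz)
  obtain ⟨G, hGc, hG⟩ := hK'.exists_extension_cube (Fin k) (by simpa using hk) hgc
  obtain ⟨G', hGc', hG'⟩ := exists_map_of_faces hne (isCompact_closedBall 0 1) hGc
    fun z _ => hKK' (G z).support_mem
  refine ⟨G', hGc', fun x hx => Realization.ext fun i => ?_⟩
  rw [hG' x (sphere_subset_closedBall hx), hG hx, hg x hx]

end PreAbstractSimplicialComplex

/-! ### Attaching a vertex along its link -/

section AttachVertex

open Set Metric

/-- The boundary of the cube `[-1, 1]^k` is a grid complex of dimension less than `k`, of which the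
mesh may be chosen so small that a given continuous function varies by less than `1` on each
cell. -/
theorem exists_grid_sphere {k : ℕ} {φ : (Fin k → ℝ) → ℝ} (hφ : ContinuousOn φ (sphere 0 1)) :
    ∃ M : ℝ, 0 < M ∧ ∃ A : Set (NonemptyInterval (Fin k → ℤ)), A.Finite ∧ IsLowerSet A ∧
      (∀ x, gridCarrier M x ∈ A ↔ x ∈ sphere 0 1) ∧
      (∀ c ∈ A, c.snd ≤ c.fst + 1) ∧
      (∀ c ∈ A, Fintype.card {i // c.fst i < c.snd i} + 1 ≤ k) ∧
      ∀ c ∈ A, ∀ x ∈ gridBox M c, ∀ y ∈ gridBox M c, |φ x - φ y| < 1 := by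
  classical
  have huc := (isCompact_sphere (0 : Fin k → ℝ) 1).uniformContinuousOn_of_continuous hφ
  obtain ⟨δ, hδ, hφδ⟩ := Metric.uniformContinuousOn_iff.1 huc 1 one_pos
  obtain ⟨m, hm⟩ := exists_nat_one_div_lt hδ
  let M : ℤ := m + 1
  have hM0 : 0 < M := by lia
  have hMR : (0 : ℝ) < M := by exact_mod_cast hM0
  let A : Set (NonemptyInterval (Fin k → ℤ)) := {c | c.snd ≤ c.fst + 1 ∧
    (∀ i, -M ≤ c.fst i ∧ c.snd i ≤ M) ∧ ∃ i, M ≤ c.fst i ∨ c.snd i ≤ -M}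
  have hbox : ∀ c ∈ A, ∀ x ∈ gridBox (M : ℝ) c, x ∈ sphere (0 : Fin k → ℝ) 1 := by
    rintro c ⟨-, hc, j, hj⟩ x hx
    have hle : ∀ i, |x i| ≤ 1 := fun i => by
      have h1 : ((-M : ℤ) : ℝ) ≤ c.fst i := by exact_mod_cast (hc i).1
      have h2 : (c.snd i : ℝ) ≤ M := by exact_mod_cast (hc i).2
      push_cast at h1
      rw [abs_le]
      constructor <;> nlinarith [(hx i).1, (hx i).2]
    rw [mem_sphere_zero_iff_norm]
    refine le_antisymm ((pi_norm_le_iff_of_nonneg zero_le_one).2 hle)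
      (le_trans ?_ (norm_le_pi_norm x j))
    rw [Real.norm_eq_abs, le_abs']
    rcases hj with hj | hj
    · right
      have h1 : (M : ℝ) ≤ c.fst j := by exact_mod_cast hj
      nlinarith [(hx j).1]
    · left
      have h1 : (c.snd j : ℝ) ≤ ((-M : ℤ) : ℝ) := by exact_mod_cast hj
      push_cast at h1
      nlinarith [(hx j).2]
  refine ⟨M, hMR, A, ?_, ?_, fun x => ⟨fun h => hbox _ h x (mem_gridBox_gridCarrier _ x), ?_⟩,
    fun c hc => hc.1, ?_, ?_⟩
  · refine Set.Finite.subset (s := NonemptyInterval.toProd ⁻¹'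
      (Icc (fun _ => -M) (fun _ => M) ×ˢ Icc (fun _ => -M) (fun _ => M))) ?_ ?_
    · exact ((finite_Icc _ _).prod (finite_Icc _ _)).preimage
        (NonemptyInterval.toProd_injective.injOn)
    · rintro c ⟨-, hc, -⟩
      exact ⟨⟨fun i => (hc i).1, fun i => (c.fst_le_snd i).trans (hc i).2⟩,
        ⟨fun i => (hc i).1.trans (c.fst_le_snd i), fun i => (hc i).2⟩⟩
  · rintro c c' hle ⟨h1, h2, j, h3⟩
    refine ⟨fun i => ?_, fun i => ⟨(h2 i).1.trans (hle.1 i), (hle.2 i).trans (h2 i).2⟩, j, ?_⟩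
    · exact (hle.2 i).trans ((h1 i).trans (add_le_add_left (hle.1 i) 1))
    · exact h3.imp (fun h => h.trans (hle.1 j)) fun h => (hle.2 j).trans h
  · intro hx
    have hx1 := mem_sphere_zero_iff_norm.1 hx
    have hle : ∀ i, |x i| ≤ 1 := fun i => hx1 ▸ norm_le_pi_norm x i
    obtain ⟨j, hj⟩ : ∃ i, 1 ≤ |x i| := by
      by_contra! hlt
      exact hx1.not_lt ((pi_norm_lt_iff one_pos).2 hlt)
    refine ⟨fun i => Int.ceil_le_floor_add_one _, fun i => ⟨Int.le_floor.2 ?_, Int.ceil_le.2 ?_⟩, j,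
      (le_abs'.1 hj).symm.imp (fun h => Int.le_floor.2 ?_) fun h => Int.ceil_le.2 ?_⟩
    · push_cast
      nlinarith [(abs_le.1 (hle i)).1]
    · nlinarith [(abs_le.1 (hle i)).2]
    · nlinarith
    · push_cast
      nlinarith
  · rintro c ⟨-, hc, j, hj⟩
    have hlt : Fintype.card {i // c.fst i < c.snd i} < Fintype.card (Fin k) :=
      Fintype.card_subtype_lt (x := j) (by
        have h1 := hc j
        have h2 := c.fst_le_snd j
        lia)
    rw [Fintype.card_fin] at hlt
    exact hlt
  · intro c hc x hx y hy
    refine hφδ x (hbox c hc x hx) y (hbox c hc y hy) (lt_of_le_of_lt ?_ hm)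
    rw [dist_pi_le_iff (by positivity)]
    intro i
    have h1 : (c.snd i : ℝ) ≤ c.fst i + 1 := by exact_mod_cast hc.1 i
    have hMm : (M : ℝ) = m + 1 := by simp [M]
    rw [Real.dist_eq, le_div_iff₀ (by positivity), ← hMm, ← abs_of_pos hMR, ← abs_mul, abs_le]
    constructor <;> nlinarith [(hx i).1, (hx i).2, (hy i).1, (hy i).2]

namespace PreAbstractSimplicialComplex

variable {ι : Type*} [DecidableEq ι] {K L Λ : PreAbstractSimplicialComplex ι} {v : ι} {d : ℤ}

/-- If the deletion `L` of a vertex `v` is `d`-connected and its link `Λ` is `(d - 1)`-connected, the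
complex is `d`-connected. A map `f` from a sphere of dimension at most `d` is cut along a fine grid
into a part `T₁` where `f` avoids `v` and a part `T₂` in the open star of `v`. Projecting away from
`v` maps `T₁` to `L`, and `T₁ ∩ T₂` to `Λ`; the connectivity of `Λ` extends the latter over `T₂`. The
resulting map to `L` extends to the ball, and two straight line homotopies lead back to `f`. -/
theorem isNConnected_of_deletion_link (hL : IsNConnected L.Realization d)
    (hΛ : IsNConnected Λ.Realization (d - 1))
    (hLK : ∀ s, s ∈ L.faces ↔ s ∈ K.faces ∧ v ∉ s)
    (hΛK : ∀ s, s ∈ Λ.faces ↔ s.Nonempty ∧ v ∉ s ∧ insert v s ∈ K.faces) :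
    IsNConnected K.Realization d := by
  classical
  by_cases hd : d ≤ -2
  · exact IsNConnected.of_le_neg_two hd
  have hLne := hL.nonempty (by lia)
  have hKne := nonempty_realization ((hLK _).1 hLne.some.support_mem).1
  refine IsNConnected.of_cube (fun _ => hKne) fun k hk f hf => ?_
  rcases Nat.eq_zero_or_pos k with rfl | hk0
  · refine ⟨fun _ => hKne.some, continuousOn_const, fun x hx => ?_⟩
    rw [mem_sphere_zero_iff_norm, Subsingleton.elim x 0, norm_zero] at hx
    exact absurd hx zero_ne_one
  have hΛne := hΛ.nonempty (by lia)
  have hΛL : ∀ s ∈ Λ.faces, s ∈ L.faces := fun s hs => by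
    obtain ⟨h1, h2, h3⟩ := (hΛK s).1 hs
    exact (hLK s).2 ⟨mem_faces_of_subset h3 (Finset.subset_insert _ _) h1, h2⟩
  obtain ⟨F, hF₀⟩ := hf.exists_finset_support (isCompact_sphere 0 1)
  have hF : ∀ x ∈ sphere (0 : Fin k → ℝ) 1, (f x).weight.support ⊆ insert v F := fun x hx =>
    (hF₀ x hx).trans (Finset.subset_insert _ _)
  -- `φ x` is the coordinate of `f x` at `v`.
  let φ : (Fin k → ℝ) → ℝ := fun x => (f x).weight v
  have hφ : ContinuousOn φ (sphere 0 1) := hf.coord v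
  have hφ0 : ∀ x, 0 ≤ φ x := fun x => (f x).weight_nonneg v
  have hφ1 : ∀ x, φ x ≤ 1 := fun x => (f x).le_one v
  obtain ⟨M, hM, A, hAf, hA, hAS, hAc, hAdim, hAφ⟩ := exists_grid_sphere hφ
  let A₁ : Set (NonemptyInterval (Fin k → ℤ)) := {c ∈ A | ∀ x ∈ gridBox M c, φ x < 1}
  let A₂ : Set (NonemptyInterval (Fin k → ℤ)) := {c ∈ A | ∀ x ∈ gridBox M c, 0 < φ x}
  have hbox : ∀ {c c' : NonemptyInterval (Fin k → ℤ)}, c' ≤ c → gridBox M c' ⊆ gridBox M c :=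
    fun h x hx => mem_gridBox.2 ((mem_gridBox.1 hx).trans h)
  have hA₁ : IsLowerSet A₁ := fun c c' h hc => ⟨hA h hc.1, fun x hx => hc.2 x (hbox h hx)⟩
  have hA₂ : IsLowerSet A₂ := fun c c' h hc => ⟨hA h hc.1, fun x hx => hc.2 x (hbox h hx)⟩
  have hA₁₂ : ∀ c ∈ A, c ∈ A₁ ∨ c ∈ A₂ := fun c hc => by
    by_contra! h
    obtain ⟨x, hx, hx'⟩ : ∃ x ∈ gridBox M c, 1 ≤ φ x := by
      by_contra! h'
      exact h.1 ⟨hc, h'⟩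
    obtain ⟨y, hy, hy'⟩ : ∃ x ∈ gridBox M c, φ x ≤ 0 := by
      by_contra! h'
      exact h.2 ⟨hc, h'⟩
    have := (abs_lt.1 (hAφ c hc x hx y hy)).2
    linarith
  let T₁ : Set (Fin k → ℝ) := {x | gridCarrier M x ∈ A₁}
  let T₂ : Set (Fin k → ℝ) := {x | gridCarrier M x ∈ A₂}
  have hT₁c : IsClosed T₁ := isClosed_gridCarrier_mem (hAf.subset fun c hc => hc.1) hA₁
  have hT₂c : IsClosed T₂ := isClosed_gridCarrier_mem (hAf.subset fun c hc => hc.1) hA₂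
  have hT₁S : T₁ ⊆ sphere 0 1 := fun x hx => (hAS x).1 hx.1
  have hT₂S : T₂ ⊆ sphere 0 1 := fun x hx => (hAS x).1 hx.1
  have hST : sphere (0 : Fin k → ℝ) 1 ⊆ T₁ ∪ T₂ := fun x hx => hA₁₂ _ ((hAS x).2 hx)
  have hφT₁ : ∀ x ∈ T₁, φ x < 1 := fun x hx => hx.2 x (mem_gridBox_gridCarrier M x)
  have hφT₂ : ∀ x ∈ T₂, 0 < φ x := fun x hx => hx.2 x (mem_gridBox_gridCarrier M x)
  -- The projection of `f` away from `v`, on `T₁` with values in `L`, on `T₁ ∩ T₂` in the link.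
  let ρ : (Fin k → ℝ) → ι → ℝ := fun x i => if i = v then 0 else (f x).weight i / (1 - φ x)
  have hρ0 : ∀ x ∈ T₁, ∀ i, 0 ≤ ρ x i := fun x hx i => by
    simp only [ρ]
    split_ifs
    exacts [le_rfl, div_nonneg ((f x).weight_nonneg i) (by linarith [hφT₁ x hx])]
  have hρ1 : ∀ x ∈ T₁, ∑ i ∈ insert v F, ρ x i = 1 := fun x hx => by
    have h1 := (f x).sum_eq_one (hF x (hT₁S hx))
    have h2 := hφT₁ x hx
    rw [← Finset.add_sum_erase _ _ (Finset.mem_insert_self v F)] at h1 ⊢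
    have h3 : ∑ i ∈ (insert v F).erase v, ρ x i
        = (∑ i ∈ (insert v F).erase v, (f x).weight i) / (1 - φ x) := by
      rw [Finset.sum_div]
      exact Finset.sum_congr rfl fun i hi => if_neg (Finset.mem_erase.1 hi).1
    rw [h3, eq_sub_of_add_eq' h1, div_self (by simp only [φ] at h2; linarith)]
    simp [ρ]
  have hρs : ∀ x i, i ∉ (f x).weight.support.erase v → ρ x i = 0 := fun x i hi => by
    simp only [ρ]
    split_ifs with h
    · rfl
    · rw [Finsupp.notMem_support_iff.1 fun h' => hi (Finset.mem_erase.2 ⟨h, h'⟩), zero_div]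
  have hρF : ∀ x ∈ T₁, ∀ i, i ∉ insert v F → ρ x i = 0 := fun x hx i hi =>
    hρs x i fun h => hi (hF x (hT₁S hx) (Finset.mem_of_mem_erase h))
  have hρc : ∀ i, ContinuousOn (fun x => ρ x i) T₁ := fun i => by
    by_cases h : i = v
    · simp only [ρ, if_pos h]
      exact continuousOn_const
    · simp only [ρ, if_neg h]
      exact ((hf.coord i).mono hT₁S).div (continuousOn_const.sub (hφ.mono hT₁S))
        fun x hx => by linarith [hφT₁ x hx]
  have hne : ∀ x ∈ T₁, ((f x).weight.support.erase v).Nonempty := fun x hx => by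
    by_contra h
    rw [Finset.not_nonempty_iff_eq_empty] at h
    have := hρ1 x hx
    rw [Finset.sum_eq_zero fun i _ => hρs x i (by simp [h])] at this
    exact zero_ne_one this
  obtain ⟨r, hrc, hr⟩ := exists_map_of_weight hLne ρ T₁ (insert v F) hρ0 hρ1
    (fun x hx => ⟨_, (hLK _).2 ⟨mem_faces_of_subset (f x).support_mem (Finset.erase_subset _ _)
      (hne x hx), Finset.notMem_erase _ _⟩, hρs x⟩) hρF hρc
  obtain ⟨q, hqc, hq⟩ := exists_map_of_weight hΛne ρ (T₁ ∩ T₂) (insert v F)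
    (fun x hx => hρ0 x hx.1) (fun x hx => hρ1 x hx.1)
    (fun x hx => ⟨_, (hΛK _).2 ⟨hne x hx.1, Finset.notMem_erase _ _, by
      rw [Finset.insert_erase (Finsupp.mem_support_iff.2 (hφT₂ x hx.2).ne')]
      exact (f x).support_mem⟩, hρs x⟩) (fun x hx => hρF x hx.1)
    fun i => (hρc i).mono inter_subset_left
  obtain ⟨h, hhc, hh⟩ := hΛ.exists_extension_grid hM (A₀ := A₁ ∩ A₂) (hA₁.inter hA₂) hqc
    (hAf.subset (fun c hc => hc.1 : A₂ ⊆ A)).toFinset (by simpa using hA₂)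
    (by simp) (fun c hc => hAc c (by simpa using hc : c ∈ A₂).1)
    (fun c hc => by
      have := hAdim c (by simpa using hc : c ∈ A₂).1
      lia)
  have hhc' : ContinuousOn h T₂ := by simpa [T₂] using hhc
  have hT₂comp : IsCompact T₂ := (isCompact_sphere _ _).of_isClosed_subset hT₂c hT₂S
  obtain ⟨h', hh'c, hh'⟩ := exists_map_of_faces (K' := L) hLne hT₂comp hhc'
    fun x _ => hΛL _ (h x).support_mem
  -- The combined map on the sphere, and its extension to the ball.
  let g : (Fin k → ℝ) → L.Realization := fun x => if x ∈ T₁ then r x else h' x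
  have hg₁ : ∀ x ∈ T₁, g x = r x := fun x hx => if_pos hx
  have hg₂ : ∀ x ∈ T₂, g x = h' x := fun x hx => by
    by_cases hx₁ : x ∈ T₁
    · refine (hg₁ x hx₁).trans (Realization.ext fun i => ?_)
      rw [hr x hx₁, hh' x hx, hh ⟨hx₁, hx⟩, hq x ⟨hx₁, hx⟩]
    · exact if_neg hx₁
  have hgc : ContinuousOn g (sphere 0 1) :=
    ((hrc.congr hg₁).union_of_isClosed (hh'c.congr hg₂) hT₁c hT₂c).mono hST
  obtain ⟨G, hGc, hG⟩ := hL.exists_extension_cube (Fin k) (by simpa using hk) hgc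
  obtain ⟨G', hGc', hG'⟩ := exists_map_of_faces (K' := K) hKne (isCompact_closedBall 0 1) hGc
    fun x _ => ((hLK _).1 (G x).support_mem).1
  have hG'w : ∀ x ∈ sphere (0 : Fin k → ℝ) 1, ∀ i, (G' x).weight i = (g x).weight i :=
    fun x hx i => by rw [hG' x (sphere_subset_closedBall hx), hG hx]
  -- The intermediate map `m` equals `v` on `T₂`, and moves to the projection of `f` where `φ`
  -- tends to zero.
  obtain ⟨ε, hε, hεφ⟩ : ∃ ε : ℝ, 0 < ε ∧ ∀ x ∈ T₂, ε ≤ φ x := by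
    rcases T₂.eq_empty_or_nonempty with hemp | hT₂ne
    · exact ⟨1, one_pos, fun x hx => by simp [hemp] at hx⟩
    · obtain ⟨x₀, hx₀, hmin⟩ := hT₂comp.exists_isMinOn hT₂ne (hφ.mono hT₂S)
      exact ⟨φ x₀, hφT₂ x₀ hx₀, fun x hx => hmin hx⟩
  let l : (Fin k → ℝ) → ℝ := fun x => min 1 (φ x / ε)
  have hl0 : ∀ x, 0 ≤ l x := fun x => le_min zero_le_one (div_nonneg (hφ0 x) hε.le)
  have hl1 : ∀ x, l x ≤ 1 := fun x => min_le_left _ _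
  have hlT₂ : ∀ x ∈ T₂, l x = 1 := fun x hx => min_eq_left ((one_le_div hε).2 (hεφ x hx))
  have hlc : ContinuousOn l (sphere 0 1) := continuousOn_const.inf (hφ.div_const ε)
  let δ : ι → ℝ := fun i => if i = v then 1 else 0
  let w : (Fin k → ℝ) → ι → ℝ := fun x i => (1 - l x) * ρ x i + l x * δ i
  have hwT₂ : ∀ x ∈ T₂, ∀ i, w x i = δ i := fun x hx i => by
    simp only [w, hlT₂ x hx]
    ring
  have hδ0 : ∀ i, 0 ≤ δ i := fun i => by simp only [δ]; split_ifs <;> norm_num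
  have hδ1 : ∑ i ∈ insert v F, δ i = 1 := by simp [δ]
  have hws : ∀ x ∈ sphere (0 : Fin k → ℝ) 1, ∀ i, i ∉ (f x).weight.support → w x i = 0 :=
    fun x hx i hi => by
      have hρi : ρ x i = 0 := hρs x i fun h => hi (Finset.mem_of_mem_erase h)
      by_cases hiv : i = v
      · have hφi : φ x = 0 := by
          rw [hiv] at hi
          exact Finsupp.notMem_support_iff.1 hi
        simp [w, hρi, l, hφi]
      · simp [w, hρi, δ, hiv]
  obtain ⟨m, hmc, hm⟩ := exists_map_of_weight hKne w (sphere 0 1) (insert v F)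
    (fun x hx i => by
      rcases hST hx with hx₁ | hx₂
      · exact add_nonneg (mul_nonneg (by linarith [hl1 x]) (hρ0 x hx₁ i))
          (mul_nonneg (hl0 x) (hδ0 i))
      · rw [hwT₂ x hx₂]
        exact hδ0 i)
    (fun x hx => by
      rcases hST hx with hx₁ | hx₂
      · simp only [w]
        rw [Finset.sum_add_distrib, ← Finset.mul_sum, ← Finset.mul_sum, hρ1 x hx₁, hδ1]
        ring
      · rw [← hδ1]
        exact Finset.sum_congr rfl fun i _ => hwT₂ x hx₂ i)
    (fun x hx => ⟨_, (f x).support_mem, hws x hx⟩)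
    (fun x hx i hi => hws x hx i fun h => hi (hF x hx h))
    (fun i => by
      refine ContinuousOn.mono (ContinuousOn.union_of_isClosed ?_ ?_ hT₁c hT₂c) hST
      · exact ((continuousOn_const.sub (hlc.mono hT₁S)).mul (hρc i)).add
          ((hlc.mono hT₁S).mul continuousOn_const)
      · exact continuousOn_const.congr fun x hx => hwT₂ x hx i)
  have hmf : ∀ x ∈ sphere (0 : Fin k → ℝ) 1, (m x).weight.support ⊆ (f x).weight.support :=
    fun x hx => Realization.support_subset _ fun i hi => by rw [hm x hx, hws x hx i hi]
  obtain ⟨m', hmc', hm'⟩ := exists_extension_of_contiguous hmc hGc' fun x hx => by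
    rcases hST hx with hx₁ | hx₂
    · refine ⟨_, (f x).support_mem, hmf x hx, Realization.support_subset _ fun i hi => ?_⟩
      rw [hG'w x hx, hg₁ x hx₁, hr x hx₁, hρs x i fun h => hi (Finset.mem_of_mem_erase h)]
    · refine ⟨_, ((hΛK _).1 (h x).support_mem).2.2, Realization.support_subset _ fun i hi => ?_,
        Realization.support_subset _ fun i hi => ?_⟩
      · rw [hm x hx, hwT₂ x hx₂]
        exact if_neg fun hiv : i = v => hi (hiv ▸ Finset.mem_insert_self _ _)
      · rw [hG'w x hx, hg₂ x hx₂, hh' x hx₂]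
        exact Finsupp.notMem_support_iff.1 fun h => hi (Finset.mem_insert_of_mem h)
  refine exists_extension_of_contiguous hf hmc' fun x hx =>
    ⟨_, (f x).support_mem, subset_rfl, ?_⟩
  rw [hm' hx]
  exact hmf x hx

end PreAbstractSimplicialComplex

end AttachVertex

/-! ### Connectivity of subsets of a poset -/

section Chains

open PreAbstractSimplicialComplex

variable {P Q : Type*} [PartialOrder P] [PartialOrder Q] {A : Set P} {n d : ℤ}

/-- The simplicial complex of non-empty finite chains in a subset `A` of a poset. Unlike the order
complex of the subtype, it has the same vertex type for all `A`. -/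
def chainComplex (A : Set P) : PreAbstractSimplicialComplex P where
  faces := {s | s.Nonempty ∧ IsChain (· ≤ ·) (s : Set P) ∧ (s : Set P) ⊆ A}
  isRelLowerSet_faces := fun _ h => ⟨h.1, fun _ hts ht =>
    ⟨ht, h.2.1.mono (Finset.coe_subset.mpr hts), (Finset.coe_subset.mpr hts).trans h.2.2⟩⟩

/-- A subset of a poset is `n`-connected if the realization of its complex of chains is. -/
def ChainConnected (A : Set P) (n : ℤ) : Prop := IsNConnected (chainComplex A).Realization n

theorem ChainConnected.of_le_neg_two (hn : n ≤ -2) : ChainConnected A n :=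
  IsNConnected.of_le_neg_two hn

theorem mem_chainComplex_insert_insert [DecidableEq P] {a : P} {s : Finset P} :
    insert a s ∈ (chainComplex (insert a A)).faces ↔
      IsChain (· ≤ ·) (s : Set P) ∧ (s : Set P) ⊆ insert a A ∧ ∀ x ∈ s, x ≤ a ∨ a ≤ x := by
  constructor
  · rintro ⟨-, h1, h2⟩
    rw [Finset.coe_insert] at h1 h2
    refine ⟨h1.mono (Set.subset_insert _ _), (Set.subset_insert _ _).trans h2, fun x hx => ?_⟩
    exact h1.total (Set.mem_insert_of_mem _ hx) (Set.mem_insert _ _)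
  · rintro ⟨h1, h2, h3⟩
    refine ⟨Finset.insert_nonempty _ _, ?_, ?_⟩
    · rw [Finset.coe_insert]
      exact h1.insert fun x hx _ => (h3 x hx).symm
    · rw [Finset.coe_insert]
      exact Set.insert_subset (Set.mem_insert _ _) h2

/-- A subset is `n`-connected for all `n` if it has an element comparable to all others. -/
theorem ChainConnected.of_comparable {a : P} (ha : a ∈ A) (h : ∀ x ∈ A, x ≤ a ∨ a ≤ x) (n : ℤ) :
    ChainConnected A n := by
  classical
  have hA : insert a A = A := Set.insert_eq_of_mem ha
  refine isNConnected_of_cone (K := chainComplex A) (v := a) ⟨Finset.singleton_nonempty a, ?_, ?_⟩ (fun s hs => ?_) n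
  · rw [Finset.coe_singleton]
    exact Set.subsingleton_singleton.isChain
  · rwa [Finset.coe_singleton, Set.singleton_subset_iff]
  · have := mem_chainComplex_insert_insert (A := A) (a := a) (s := s)
    rw [hA] at this
    exact this.2 ⟨hs.2.1, hs.2.2, fun x hx => h x (hs.2.2 hx)⟩

theorem ChainConnected.insert_of_link {b : P} (hb : b ∉ A) (hA : ChainConnected A d)
    (hl : ChainConnected {a ∈ A | a ≤ b ∨ b ≤ a} (d - 1)) : ChainConnected (insert b A) d := by
  classical
  refine isNConnected_of_deletion_link (v := b) hA hl (fun s => ⟨fun hs => ?_, fun hs => ?_⟩)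
    fun s => ⟨fun hs => ?_, fun hs => ?_⟩
  · exact ⟨⟨hs.1, hs.2.1, hs.2.2.trans (Set.subset_insert _ _)⟩, fun h => hb (hs.2.2 h)⟩
  · exact ⟨hs.1.1, hs.1.2.1, fun x hx =>
      (hs.1.2.2 hx).resolve_left fun h => hs.2 (h ▸ hx)⟩
  · exact ⟨hs.1, fun h => hb (hs.2.2 h).1, mem_chainComplex_insert_insert.2
      ⟨hs.2.1, fun x hx => Or.inr (hs.2.2 hx).1, fun x hx => (hs.2.2 hx).2⟩⟩
  · obtain ⟨h1, h2, h3⟩ := hs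
    obtain ⟨h4, h5, h6⟩ := mem_chainComplex_insert_insert.1 h3
    exact ⟨h1, h4, fun x hx => ⟨(h5 hx).resolve_left fun h => h2 (h ▸ hx), h6 x hx⟩⟩

theorem ChainConnected.of_finite
    (h : ∀ F : Finset P, ∃ A' ⊆ A, (∀ x ∈ A, x ∈ F → x ∈ A') ∧ ChainConnected A' n) :
    ChainConnected A n := by
  refine isNConnected_of_finite fun F => ?_
  obtain ⟨A', hA', hF, hc⟩ := h F
  exact ⟨chainComplex A', fun s hs => ⟨hs.1, hs.2.1, hs.2.2.trans hA'⟩,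
    fun s hs hsF => ⟨hs.1, hs.2.1, fun x hx => hF x (hs.2.2 hx) (hsF hx)⟩, hc⟩

theorem IsChain.image_of_monotoneOn {e : P → Q} {s : Set P} (hs : IsChain (· ≤ ·) s)
    (he : MonotoneOn e s) : IsChain (· ≤ ·) (e '' s) := by
  rintro _ ⟨x, hx, rfl⟩ _ ⟨y, hy, rfl⟩ -
  exact (hs.total hx hy).imp (he hx hy) (he hy hx)

theorem ChainConnected.of_retract {B : Set Q} (hB : ChainConnected B n) (e : P → Q) (e' : Q → P)
    (he : MonotoneOn e A) (he' : MonotoneOn e' B) (heB : Set.MapsTo e A B)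
    (heA : Set.MapsTo e' B A) (hee : ∀ x ∈ A, e' (e x) = x) : ChainConnected A n := by
  classical
  refine isNConnected_of_retract hB e e' (fun s hs => ?_) (fun s hs => ?_)
    fun s hs i hi => hee i (hs.2.2 hi)
  · refine ⟨hs.1.image e, ?_, ?_⟩ <;> rw [Finset.coe_image]
    · exact hs.2.1.image_of_monotoneOn (he.mono hs.2.2)
    · exact (heB.mono_left hs.2.2).image_subset
  · refine ⟨hs.1.image e', ?_, ?_⟩ <;> rw [Finset.coe_image]
    · exact hs.2.1.image_of_monotoneOn (he'.mono hs.2.2)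
    · exact (heA.mono_left hs.2.2).image_subset

/-- A poset is as connected as its image under an order embedding. -/
theorem ChainConnected.isNConnectedPoset {P : Type*} [PartialOrder P] (e : P ↪o Q)
    (h : ChainConnected (Set.range e) n) : IsNConnectedPoset P n := by
  classical
  by_cases hn : n ≤ -2
  · exact IsNConnected.of_le_neg_two hn
  obtain ⟨w⟩ := IsNConnected.nonempty h (by lia)
  obtain ⟨x, hx⟩ := w.support_mem.1
  obtain ⟨p, -⟩ := w.support_mem.2.2 hx
  have : Nonempty P := ⟨p⟩
  have hinv : ∀ p, Function.invFun e (e p) = p := Function.leftInverse_invFun e.injective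
  refine isNConnected_of_retract h e (Function.invFun e) (fun s hs => ?_) (fun s hs => ?_)
    fun s hs i hi => hinv i
  · refine ⟨hs.1.image e, ?_, ?_⟩ <;> rw [Finset.coe_image]
    · exact hs.2.image_of_monotoneOn (e.monotone.monotoneOn _)
    · exact Set.image_subset_range _ _
  · refine ⟨hs.1.image _, ?_⟩
    rw [Finset.coe_image]
    refine hs.2.1.image_of_monotoneOn fun x hx y hy hxy => ?_
    obtain ⟨a, rfl⟩ := hs.2.2 hx
    obtain ⟨b, rfl⟩ := hs.2.2 hy
    rw [hinv, hinv]
    exact e.le_iff_le.1 hxy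

/-- Connectivity is preserved under adding a finite set `E` of elements if they can be added one by
one in such a way that the link of each new element is a cone with apex in `A`. -/
theorem ChainConnected.union_finset (hA : ChainConnected A n) (E : Finset P)
    (hAE : ∀ b ∈ E, b ∉ A)
    (h : ∀ E' ⊆ E, E'.Nonempty → ∃ b ∈ E', ∃ a ∈ A, (a ≤ b ∨ b ≤ a) ∧
      ∀ x, x ∈ A ∨ x ∈ E' ∧ x ≠ b → x ≤ b ∨ b ≤ x → x ≤ a ∨ a ≤ x) :
    ChainConnected (A ∪ E) n := by
  classical
  induction E using Finset.strongInduction with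
  | H E ih =>
  rcases E.eq_empty_or_nonempty with rfl | hE
  · simpa using hA
  obtain ⟨b, hb, a, ha, hab, hcone⟩ := h E subset_rfl hE
  have hins : A ∪ (E : Set P) = insert b (A ∪ (E.erase b : Finset P)) := by
    rw [← Set.union_insert, ← Finset.coe_insert, Finset.insert_erase hb]
  rw [hins]
  refine ChainConnected.insert_of_link ?_ (ih _ (Finset.erase_ssubset hb)
    (fun b' hb' => hAE b' (Finset.mem_of_mem_erase hb'))
    fun E' hE' => h E' (hE'.trans (Finset.erase_subset _ _))) ?_
  · rintro (h | h)
    exacts [hAE b hb h, Finset.notMem_erase _ _ h]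
  · refine ChainConnected.of_comparable (A := {x ∈ A ∪ (E.erase b : Finset P) | x ≤ b ∨ b ≤ x})
      (a := a) ⟨Or.inl ha, hab⟩ (fun x hx => ?_) _
    exact hcone x (hx.1.imp id fun h => (Finset.mem_erase.1 h).symm) hx.2

end Chains

/-! ### Connectivity of sets of simplices -/

section Faces

variable {ι : Type*} [DecidableEq ι] {S : Set (Finset ι)} {v : ι} {d : ℤ}

theorem ChainConnected.of_insert_mem (hv : {v} ∈ S) (h : ∀ s ∈ S, insert v s ∈ S) (n : ℤ) :
    ChainConnected S n := by
  have hA : ChainConnected {s ∈ S | v ∈ s} n := by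
    refine ChainConnected.of_comparable (A := {s ∈ S | v ∈ s}) (a := {v}) ⟨hv, Finset.mem_singleton_self v⟩
      (fun s hs => Or.inr (Finset.singleton_subset_iff.2 hs.2)) n
  refine ChainConnected.of_finite fun F => ?_
  classical
  refine ⟨_, ?_, ?_, hA.union_finset (F.filter fun s => s ∈ S ∧ v ∉ s)
    (fun b hb hb' => (Finset.mem_filter.1 hb).2.2 hb'.2) fun E' hE' hne => ?_⟩
  · rintro s (hs | hs)
    exacts [hs.1, (Finset.mem_filter.1 hs).2.1]
  · intro s hs hsF
    by_cases hvs : v ∈ s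
    · exact Or.inl ⟨hs, hvs⟩
    · exact Or.inr (Finset.mem_filter.2 ⟨hsF, hs, hvs⟩)
  · obtain ⟨b, hb⟩ := E'.exists_maximal hne
    obtain ⟨-, hbS, hvb⟩ := Finset.mem_filter.1 (hE' hb.1)
    refine ⟨b, hb.1, insert v b, ⟨h b hbS, Finset.mem_insert_self _ _⟩,
      Or.inr (Finset.subset_insert _ _), fun x hx hxb => ?_⟩
    rcases hx with hx | hx
    · rcases hxb with hxb | hxb
      · exact absurd (hxb hx.2) hvb
      · exact Or.inr (Finset.insert_subset hx.2 hxb)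
    · rcases hxb with hxb | hxb
      · exact Or.inl (hxb.trans (Finset.subset_insert _ _))
      · exact absurd (le_antisymm (hb.2 hx.1 hxb) hxb) hx.2

/-- The version for face posets of `isNConnected_of_deletion_link`. The simplices containing `v`
other than `{v}` have contractible links if they are added in decreasing order, and the link of
`{v}` in what precedes is the face poset of the link of `v`. -/
theorem ChainConnected.of_deletion_link (hS : IsRelLowerSet S Finset.Nonempty)
    (hdel : ChainConnected {s ∈ S | v ∉ s} d)
    (hlink : {v} ∈ S → ChainConnected {s | s.Nonempty ∧ v ∉ s ∧ insert v s ∈ S} (d - 1)) :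
    ChainConnected S d := by
  classical
  by_cases hv : {v} ∈ S
  swap
  · have : {s ∈ S | v ∉ s} = S := Set.sep_eq_self_iff_mem_true.2 fun s hs hvs =>
      hv ((hS hs).2 (Finset.singleton_subset_iff.2 hvs) (Finset.singleton_nonempty v))
    rwa [this] at hdel
  have hQ : ChainConnected {s ∈ S | s ≠ {v}} d := by
    refine ChainConnected.of_finite fun F => ?_
    refine ⟨_, ?_, ?_, hdel.union_finset (F.filter fun s => s ∈ S ∧ v ∈ s ∧ s ≠ {v})
      (fun b hb hb' => hb'.2 (Finset.mem_filter.1 hb).2.2.1) fun E' hE' hne => ?_⟩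
    · rintro s (hs | hs)
      · exact ⟨hs.1, fun h => hs.2 (h ▸ Finset.mem_singleton_self v)⟩
      · exact ⟨(Finset.mem_filter.1 hs).2.1, (Finset.mem_filter.1 hs).2.2.2⟩
    · intro s hs hsF
      by_cases hvs : v ∈ s
      · exact Or.inr (Finset.mem_filter.2 ⟨hsF, hs.1, hvs, hs.2⟩)
      · exact Or.inl ⟨hs.1, hvs⟩
    · obtain ⟨b, hb⟩ := E'.exists_minimal hne
      obtain ⟨-, hbS, hvb, hbv⟩ := Finset.mem_filter.1 (hE' hb.1)
      have hne' : (b.erase v).Nonempty := by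
        rw [Finset.nonempty_iff_ne_empty, Ne, Finset.erase_eq_empty_iff]
        rintro (h | h)
        exacts [by simp [h] at hvb, hbv h]
      refine ⟨b, hb.1, b.erase v,
        ⟨(hS hbS).2 (Finset.erase_subset _ _) hne', Finset.notMem_erase _ _⟩,
        Or.inl (Finset.erase_subset _ _), fun x hx hxb => ?_⟩
      rcases hx with hx | hx
      · rcases hxb with hxb | hxb
        · exact Or.inl (Finset.subset_erase.2 ⟨hxb, hx.2⟩)
        · exact absurd (hxb hvb) hx.2
      · rcases hxb with hxb | hxb
        · exact absurd (le_antisymm hxb (hb.2 hx.1 hxb)) hx.2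
        · exact Or.inr ((Finset.erase_subset _ _).trans hxb)
  have hSQ : insert {v} {s ∈ S | s ≠ {v}} = S := by
    ext s
    by_cases h : s = {v} <;> simp [h, hv]
  rw [← hSQ]
  refine hQ.insert_of_link (fun h => h.2 rfl) ((hlink hv).of_retract (fun s => s.erase v)
    (fun s => insert v s) (fun s _ t _ hst => Finset.erase_subset_erase _ hst)
    (fun s _ t _ hst => Finset.insert_subset_insert _ hst) ?_ ?_ ?_)
  all_goals
    have hmem : ∀ s ∈ {a ∈ {s ∈ S | s ≠ {v}} | a ≤ {v} ∨ {v} ≤ a}, v ∈ s := by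
      rintro s ⟨⟨hs, hsv⟩, h | h⟩
      · exact absurd ((Finset.subset_singleton_iff.1 h).resolve_left
          (hS hs).1.ne_empty) hsv
      · exact Finset.singleton_subset_iff.1 h
  · intro s hs
    refine ⟨?_, Finset.notMem_erase _ _, ?_⟩
    · rw [Finset.nonempty_iff_ne_empty, Ne, Finset.erase_eq_empty_iff]
      rintro (h | h)
      exacts [(hS hs.1.1).1.ne_empty h, hs.1.2 h]
    · rw [Finset.insert_erase (hmem s hs)]
      exact hs.1.1
  · rintro s ⟨hs, hvs, hins⟩
    refine ⟨⟨hins, fun h => ?_⟩, Or.inr (Finset.singleton_subset_iff.2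
      (Finset.mem_insert_self _ _))⟩
    obtain ⟨x, hx⟩ := hs
    have := Finset.mem_singleton.1 (h ▸ Finset.mem_insert_of_mem hx : x ∈ ({v} : Finset ι))
    exact hvs (this ▸ hx)
  · exact fun s hs => Finset.insert_erase (hmem s hs)

/-- The boundary of a simplex with `m` vertices is a sphere of dimension `m - 2`. -/
theorem chainConnected_boundary (T : Finset ι) :
    ChainConnected {s : Finset ι | s.Nonempty ∧ s ⊂ T} ((T.card : ℤ) - 3) := by
  induction T using Finset.induction_on with
  | empty => exact ChainConnected.of_le_neg_two (by simp)
  | insert v T hv ih =>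
  rcases T.eq_empty_or_nonempty with rfl | ⟨w, hw⟩
  · exact ChainConnected.of_le_neg_two (by simp)
  refine ChainConnected.of_deletion_link (v := v) ?_ ?_ fun _ => ?_
  · exact fun s hs => ⟨hs.1, fun t hts ht => ⟨ht, lt_of_le_of_lt hts hs.2⟩⟩
  · have : ∀ s : Finset ι, (s ⊂ insert v T ∧ v ∉ s) ↔ s ⊆ T := fun s => by
      constructor
      · rintro ⟨h1, h2⟩
        exact (Finset.subset_insert_iff_of_notMem h2).1 h1.subset
      · exact fun h => ⟨lt_of_le_of_lt h (Finset.ssubset_insert hv), fun h' => hv (h h')⟩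
    refine ChainConnected.of_insert_mem (v := w) ?_ (fun s hs => ?_) _
    · obtain ⟨h1, h2⟩ := (this {w}).2 (Finset.singleton_subset_iff.2 hw)
      exact ⟨⟨Finset.singleton_nonempty w, h1⟩, h2⟩
    · obtain ⟨h1, h2⟩ := (this (insert w s)).2
        (Finset.insert_subset hw ((this s).1 ⟨hs.1.2, hs.2⟩))
      exact ⟨⟨Finset.insert_nonempty _ _, h1⟩, h2⟩
  · convert ih using 1
    · ext s
      simp only [Set.mem_ofPred_eq, Finset.insert_nonempty, true_and]
      refine and_congr_right fun _ => ⟨fun ⟨h1, h2⟩ => ?_, fun h => ⟨fun h' => hv (h.subset h'), ?_⟩⟩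
      · refine ⟨(Finset.insert_subset_insert_iff h1).1 h2.subset, fun h => h2.2 ?_⟩
        exact Finset.insert_subset_insert v h
      · refine ⟨Finset.insert_subset_insert v h.subset, fun h' => h.2 ?_⟩
        exact (Finset.insert_subset_insert_iff hv).1 h'
    · rw [Finset.card_insert_of_notMem hv]
      push_cast
      ring

end Faces

/-! ### Unimodular sets and functionals -/

section Functionals

variable {N : Type*} [AddCommGroup N] {D : Submodule ℤ (Module.Dual ℤ N)}

/-- A set of vectors is unimodular with respect to a module `D` of functionals if it has a dual
family in `D`. If `D` consists of the functionals that vanish on a summand, this is unimodularity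
modulo that summand. -/
def IsDualizable (D : Submodule ℤ (Module.Dual ℤ N)) (s : Finset N) : Prop :=
  ∀ x ∈ s, ∃ h ∈ D, h x = 1 ∧ ∀ y ∈ s, y ≠ x → h y = 0

/-- The submodule of the functionals in `D` that vanish on `s`. -/
def vanishingOn (D : Submodule ℤ (Module.Dual ℤ N)) (s : Set N) :
    Submodule ℤ (Module.Dual ℤ N) where
  carrier := {h | h ∈ D ∧ ∀ y ∈ s, h y = 0}
  add_mem' := fun ha hb => ⟨D.add_mem ha.1 hb.1, fun y hy => by simp [ha.2 y hy, hb.2 y hy]⟩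
  zero_mem' := ⟨D.zero_mem, fun _ _ => rfl⟩
  smul_mem' := fun c _ ha => ⟨D.smul_mem c ha.1, fun y hy => by simp [ha.2 y hy]⟩

theorem mem_vanishingOn {s : Set N} {h : Module.Dual ℤ N} :
    h ∈ vanishingOn D s ↔ h ∈ D ∧ ∀ y ∈ s, h y = 0 := Iff.rfl

theorem vanishingOn_vanishingOn (s t : Set N) :
    vanishingOn (vanishingOn D s) t = vanishingOn D (s ∪ t) := by
  ext h
  simp only [mem_vanishingOn, Set.mem_union, or_imp, forall_and, and_assoc]

theorem vanishingOn_empty : vanishingOn D (∅ : Set N) = D := by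
  ext h
  simp [mem_vanishingOn]

theorem IsDualizable.mono {s t : Finset N} (hs : IsDualizable D s) (hts : t ⊆ s) :
    IsDualizable D t := fun x hx => by
  obtain ⟨h, hD, h1, h2⟩ := hs x (hts hx)
  exact ⟨h, hD, h1, fun y hy => h2 y (hts hy)⟩

theorem IsDualizable.disjoint {s t : Finset N}
    (ht : IsDualizable (vanishingOn D (s : Set N)) t) : Disjoint s t :=
  Finset.disjoint_left.2 fun x hxs hxt => by
    obtain ⟨h, hD, h1, -⟩ := ht x hxt
    exact one_ne_zero (h1.symm.trans (hD.2 x hxs))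

/-- Dual families for `s`, and for `t` modulo `s`, combine to one for the union. -/
theorem IsDualizable.union [DecidableEq N] {s t : Finset N} (hs : IsDualizable D s)
    (ht : IsDualizable (vanishingOn D (s : Set N)) t) : IsDualizable D (s ∪ t) := by
  intro x hx
  by_cases hxt : x ∈ t
  · obtain ⟨h, hD, h1, h2⟩ := ht x hxt
    refine ⟨h, hD.1, h1, fun y hy hyx => ?_⟩
    rcases Finset.mem_union.1 hy with hy | hy
    exacts [hD.2 y hy, h2 y hy hyx]
  · have hxs := (Finset.mem_union.1 hx).resolve_right hxt
    obtain ⟨h, hD, h1, h2⟩ := hs x hxs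
    choose! g hgD hg1 hg2 using ht
    refine ⟨h - ∑ y ∈ t, h y • g y,
      D.sub_mem hD (D.sum_mem fun y hy => D.smul_mem _ (hgD y hy).1), ?_, fun z hz hzx => ?_⟩
    · rw [LinearMap.sub_apply, LinearMap.sum_apply, h1, Finset.sum_eq_zero, sub_zero]
      intro y hy
      rw [LinearMap.smul_apply, (hgD y hy).2 x hxs, smul_zero]
    · rw [LinearMap.sub_apply, LinearMap.sum_apply]
      by_cases hzt : z ∈ t
      · rw [Finset.sum_eq_single_of_mem z hzt fun y hy hyz => by
          rw [LinearMap.smul_apply, hg2 y hy z hzt hyz.symm, smul_zero]]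
        simp [hg1 z hzt]
      · have hzs := (Finset.mem_union.1 hz).resolve_right hzt
        rw [h2 z hzs hzx, Finset.sum_eq_zero, sub_zero]
        intro y hy
        rw [LinearMap.smul_apply, (hgD y hy).2 z hzs, smul_zero]

theorem IsDualizable.of_union_left [DecidableEq N] {s t : Finset N} (h : IsDualizable D (s ∪ t))
    (hst : Disjoint s t) : IsDualizable (vanishingOn D (s : Set N)) t := fun x hx => by
  obtain ⟨h, hD, h1, h2⟩ := h x (Finset.mem_union_right _ hx)
  exact ⟨h, ⟨hD, fun y hy => h2 y (Finset.mem_union_left _ hy)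
    fun hyx => Finset.disjoint_left.1 hst hy (hyx ▸ hx)⟩, h1,
    fun y hy => h2 y (Finset.mem_union_right _ hy)⟩

/-- The simplices with vertices in `V` that are unimodular with respect to `D`. -/
def dualizableFaces (D : Submodule ℤ (Module.Dual ℤ N)) (V : Set N) : Set (Finset N) :=
  {s | s.Nonempty ∧ (s : Set N) ⊆ V ∧ IsDualizable D s}

theorem isRelLowerSet_dualizableFaces (V : Set N) :
    IsRelLowerSet (dualizableFaces D V) Finset.Nonempty :=
  fun _ hs => ⟨hs.1, fun _ hts ht =>
    ⟨ht, (Finset.coe_subset.2 hts).trans hs.2.1, hs.2.2.mono hts⟩⟩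

/-- If the complex on the vertices `Y` is `d`-connected, and modulo every simplex `s` without vertex
in `Y` it is `(d - |s|)`-connected, then the complex on a larger vertex set is `d`-connected: finitely
many vertices may be added one by one, since the hypothesis passes to their links. -/
theorem chainConnected_of_links [DecidableEq N] {Y V : Set N} (hYV : Y ⊆ V) {d : ℤ}
    (hY : ChainConnected (dualizableFaces D Y) d)
    (h : ∀ s ∈ dualizableFaces D V, Disjoint (s : Set N) Y →
      ChainConnected (dualizableFaces (vanishingOn D (s : Set N)) Y) (d - s.card)) :
    ChainConnected (dualizableFaces D V) d := by
  have key : ∀ E : Finset N, (E : Set N) ⊆ V → Disjoint (E : Set N) Y →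
      ∀ (D : Submodule ℤ (Module.Dual ℤ N)) (d : ℤ), ChainConnected (dualizableFaces D Y) d →
      (∀ s ∈ dualizableFaces D V, Disjoint (s : Set N) Y →
        ChainConnected (dualizableFaces (vanishingOn D (s : Set N)) Y) (d - s.card)) →
      ChainConnected (dualizableFaces D (Y ∪ E)) d := by
    intro E
    induction E using Finset.induction_on with
    | empty =>
      intro _ _ D d hY _
      simpa using hY
    | insert y E hy ih =>
    intro hEV hEY D d hY h
    rw [Finset.coe_insert] at hEV hEY
    obtain ⟨hyV, hEV⟩ := Set.insert_subset_iff.1 hEV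
    obtain ⟨hyY, hEY⟩ := Set.disjoint_insert_left.1 hEY
    have hyYE : y ∉ Y ∪ E := fun h => h.elim hyY hy
    refine ChainConnected.of_deletion_link (v := y) (isRelLowerSet_dualizableFaces _) ?_
      fun hyS => ?_
    · convert ih hEV hEY D d hY h using 1
      ext s
      rw [Finset.coe_insert, Set.union_insert]
      constructor
      · rintro ⟨⟨h1, h2, h3⟩, h4⟩
        exact ⟨h1, (Set.subset_insert_iff_of_notMem h4).1 h2, h3⟩
      · rintro ⟨h1, h2, h3⟩
        exact ⟨⟨h1, h2.trans (Set.subset_insert _ _), h3⟩, fun h => hyYE (h2 h)⟩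
    · convert ih hEV hEY (vanishingOn D (({y} : Finset N) : Set N)) (d - 1) ?_ ?_ using 1
      · ext s
        rw [Finset.coe_insert, Set.union_insert]
        constructor
        · rintro ⟨h1, h2, h3⟩
          refine ⟨h1, fun x hx => (h3.2.1 (Finset.mem_insert_of_mem hx)).resolve_left ?_,
            IsDualizable.of_union_left (by rw [← Finset.insert_eq]; exact h3.2.2)
              (Finset.disjoint_singleton_left.2 h2)⟩
          exact fun hxy => h2 (hxy ▸ hx)
        · rintro ⟨h1, h2, h3⟩
          refine ⟨h1, fun h => hyYE (h2 h), Finset.insert_nonempty _ _, ?_, ?_⟩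
          · rw [Finset.coe_insert]
            exact Set.insert_subset_insert h2
          · rw [Finset.insert_eq]
            exact hyS.2.2.union h3
      · have := h {y} ⟨Finset.singleton_nonempty y, by simpa using hyV, hyS.2.2⟩ (by simpa using hyY)
        simpa using this
      · intro s hs hsY
        have hdisj := hs.2.2.disjoint
        have := h ({y} ∪ s) ⟨⟨y, by simp⟩, by
            rw [Finset.coe_union, Finset.coe_singleton]
            exact Set.union_subset (by simpa using hyV) hs.2.1, hyS.2.2.union hs.2.2⟩ (by
            rw [Finset.coe_union, Finset.coe_singleton]
            exact Disjoint.union_left (by simpa using hyY) hsY)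
        rw [vanishingOn_vanishingOn, ← Finset.coe_union]
        convert this using 1
        rw [Finset.card_union_of_disjoint hdisj, Finset.card_singleton]
        push_cast
        ring
  refine ChainConnected.of_finite fun F => ?_
  classical
  refine ⟨_, ?_, ?_, key ((F.biUnion id).filter fun x => x ∈ V ∧ x ∉ Y)
    (fun x hx => (Finset.mem_filter.1 hx).2.1)
    (Set.disjoint_left.2 fun x hx => (Finset.mem_filter.1 hx).2.2) D d hY h⟩
  · refine fun s hs => ⟨hs.1, hs.2.1.trans (Set.union_subset hYV fun x hx => ?_), hs.2.2⟩
    exact (Finset.mem_filter.1 hx).2.1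
  · refine fun s hs hsF => ⟨hs.1, fun x hx => ?_, hs.2.2⟩
    by_cases hxY : x ∈ Y
    · exact Or.inl hxY
    · exact Or.inr (Finset.mem_filter.2
        ⟨Finset.mem_biUnion.2 ⟨s, hsF, hx⟩, hs.2.1 hx, hxY⟩)

end Functionals

/-! ### Splitting off vectors -/

section Splitting

/-- By Smith normal form, every integer vector is a multiple of the first vector of some basis. -/
theorem exists_linearEquiv_eq_single {t : ℕ} (z : Fin (t + 1) → ℤ) :
    ∃ (T : (Fin (t + 1) → ℤ) ≃ₗ[ℤ] (Fin (t + 1) → ℤ)) (d : ℤ), T z = d • Pi.single 0 1 := by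
  obtain ⟨k, B, d, hz⟩ : ∃ (k : Fin (t + 1)) (B : Module.Basis (Fin (t + 1)) ℤ (Fin (t + 1) → ℤ))
      (d : ℤ), z = d • B k := by
    obtain ⟨n, S⟩ := Submodule.smithNormalForm (Pi.basisFun ℤ (Fin (t + 1)))
      (Submodule.span ℤ {z})
    have hz : z ∈ Submodule.span ℤ {z} := Submodule.mem_span_singleton_self z
    have hsum := congrArg Subtype.val (S.bN.sum_repr ⟨z, hz⟩)
    have hn : n ≤ 1 := by
      have h1 := Module.finrank_eq_card_basis S.bN
      rw [Fintype.card_fin] at h1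
      rw [← h1]
      simpa using finrank_span_le_card (R := ℤ) ({z} : Set (Fin (t + 1) → ℤ))
    rcases Nat.le_one_iff_eq_zero_or_eq_one.1 hn with rfl | rfl
    · refine ⟨0, S.bM, 0, ?_⟩
      simpa using hsum.symm
    · refine ⟨S.f 0, S.bM, S.bN.repr ⟨z, hz⟩ 0 * S.a 0, ?_⟩
      rw [Fin.sum_univ_one, Submodule.coe_smul, S.snf] at hsum
      rw [mul_smul]
      exact hsum.symm
  refine ⟨(B.reindex (Equiv.swap k 0)).equivFun, d, ?_⟩
  have : B k = B.reindex (Equiv.swap k 0) 0 := by simp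
  rw [hz, this, map_smul]
  congr 1
  ext i
  simp [Module.Basis.equivFun_apply, Finsupp.single_apply, Pi.single_apply, eq_comm]

variable {N : Type*} [AddCommGroup N] {D : Submodule ℤ (Module.Dual ℤ N)} {V : Set N}

/-- `V` contains a translate of a free module of rank `t` which is a direct summand in the sense that
it has a retraction with coordinates in `D`. -/
def HasAffineSummand (t : ℕ) (D : Submodule ℤ (Module.Dual ℤ N)) (V : Set N) : Prop :=
  ∃ (v : N) (u : (Fin t → ℤ) →ₗ[ℤ] N) (r : N →ₗ[ℤ] (Fin t → ℤ)),
    (∀ ξ : (Fin t → ℤ) →ₗ[ℤ] ℤ, ξ ∘ₗ r ∈ D) ∧ (∀ c, r (u c) = c) ∧ ∀ c, v + u c ∈ V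

/-- `V` contains two translates, by `v` and `v + e`, of a free module of rank `t`, such that this
module is a direct summand as in `HasAffineSummand`, and a functional in `D` has the constant
values `0` and `1` on the two translates. -/
def HasAffinePair (t : ℕ) (D : Submodule ℤ (Module.Dual ℤ N)) (V : Set N) : Prop :=
  ∃ (v e : N) (u : (Fin t → ℤ) →ₗ[ℤ] N) (r : N →ₗ[ℤ] (Fin t → ℤ)) (φ : Module.Dual ℤ N),
    (∀ ξ : (Fin t → ℤ) →ₗ[ℤ] ℤ, ξ ∘ₗ r ∈ D) ∧ φ ∈ D ∧ (∀ c, r (u c) = c) ∧ (∀ c, φ (u c) = 0) ∧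
      φ v = 0 ∧ φ e = 1 ∧ (∀ c, v + u c ∈ V) ∧ ∀ c, v + e + u c ∈ V

/-- Split off one basis vector `e` of the summand, and use its coordinate as functional; the base
point is moved by a multiple of `e` so that the functional vanishes there. -/
theorem HasAffineSummand.hasAffinePair {t : ℕ} (h : HasAffineSummand (t + 1) D V) :
    HasAffinePair t D V := by
  obtain ⟨v, u, r, hr, hru, hV⟩ := h
  let j : (Fin t → ℤ) →ₗ[ℤ] (Fin (t + 1) → ℤ) :=
    LinearMap.pi (Fin.cases 0 fun i => LinearMap.proj i)
  let p : (Fin (t + 1) → ℤ) →ₗ[ℤ] (Fin t → ℤ) := LinearMap.pi fun i => LinearMap.proj i.succ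
  let e₀ : Fin (t + 1) → ℤ := Pi.single 0 1
  let φ : Module.Dual ℤ N := LinearMap.proj 0 ∘ₗ r
  have hφu : ∀ c, φ (u c) = c 0 := fun c => by simp [φ, hru]
  have hj : ∀ c, j c 0 = 0 := fun c => by simp [j]
  refine ⟨v - φ v • u e₀, u e₀, u ∘ₗ j, p ∘ₗ r, φ, fun ξ => ?_, hr _, fun c => ?_, fun c => ?_, ?_,
    ?_, fun c => ?_, fun c => ?_⟩
  · exact hr (ξ ∘ₗ p)
  · funext i
    simp [hru, p, j]
  · exact (hφu _).trans (hj c)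
  · rw [map_sub, map_smul, hφu]
    simp [e₀]
  · rw [hφu]
    simp [e₀]
  · convert hV (-φ v • e₀ + j c) using 1
    rw [map_add, map_smul, LinearMap.comp_apply]
    module
  · convert hV (-φ v • e₀ + e₀ + j c) using 1
    rw [map_add, map_add, map_smul, LinearMap.comp_apply]
    module

/-- Passing to the functionals that vanish on one more vector costs at most one dimension. -/
theorem HasAffineSummand.vanishingOn_singleton {t : ℕ} (h : HasAffineSummand (t + 1) D V) (y : N) :
    HasAffineSummand t (vanishingOn D {y}) V := by
  obtain ⟨v, u, r, hr, hru, hV⟩ := h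
  obtain ⟨T, d, hT⟩ := exists_linearEquiv_eq_single (r y)
  let j : (Fin t → ℤ) →ₗ[ℤ] (Fin (t + 1) → ℤ) :=
    LinearMap.pi (Fin.cases 0 fun i => LinearMap.proj i)
  let p : (Fin (t + 1) → ℤ) →ₗ[ℤ] (Fin t → ℤ) := LinearMap.pi fun i => LinearMap.proj i.succ
  refine ⟨v, u ∘ₗ T.symm.toLinearMap ∘ₗ j, p ∘ₗ T.toLinearMap ∘ₗ r,
    fun ξ => ⟨hr (ξ ∘ₗ p ∘ₗ T.toLinearMap), ?_⟩, fun c => ?_, fun c => hV _⟩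
  · intro x hx
    have : p (T (r x)) = 0 := by
      rw [Set.mem_singleton_iff.1 hx, hT]
      funext i
      simp [p]
    simp [this]
  · funext i
    simp [hru, p, j]

theorem HasAffineSummand.vanishingOn_finset [DecidableEq N] {t : ℕ} (h : HasAffineSummand t D V)
    (s : Finset N) (hs : s.card ≤ t) :
    HasAffineSummand (t - s.card) (vanishingOn D (s : Set N)) V := by
  induction s using Finset.induction_on with
  | empty => simpa [vanishingOn_empty] using h
  | insert y s hy ih =>
  rw [Finset.card_insert_of_notMem hy] at hs ⊢
  have ih := ih (by lia)
  rw [show t - s.card = t - (s.card + 1) + 1 by lia] at ih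
  have := ih.vanishingOn_singleton y
  rw [vanishingOn_vanishingOn, Set.union_singleton] at this
  rwa [Finset.coe_insert]

/-- The analogue of `HasAffineSummand.vanishingOn_singleton` for pairs of translates, for a vector
`y` at which some functional in `D` takes the value `1`. A rank of at least two is needed in order
to find a functional `f` in `D` with `f y = 1` which also takes the value `1` on the summand: its
kernel contains translates of a summand of corank one of both cosets, and the required functionals
are corrected by multiples of `f`. -/
theorem HasAffinePair.vanishingOn_singleton {t : ℕ} (hV : HasAffinePair (t + 2) D V) {y : N}
    {h : Module.Dual ℤ N} (hD : h ∈ D) (hy : h y = 1) :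
    HasAffinePair (t + 1) (vanishingOn D {y}) V := by
  obtain ⟨v, e, u, r, φ, hr, hφD, hru, hφu, hφv, hφe, hV, hVe⟩ := hV
  obtain ⟨T, d, hT⟩ := exists_linearEquiv_eq_single (r y)
  let c₀ : Fin (t + 2) → ℤ := T.symm (Pi.single 0 1)
  let c₁ : Fin (t + 2) → ℤ := T.symm (Pi.single 1 1)
  have hry : r y = d • c₀ := by
    rw [← T.symm_apply_apply (r y), hT, map_smul]
  -- Since `h y = 1`, the content `d` of `r y` is invertible modulo the content of the remaining
  -- part of `y`; the coefficient `α` is an inverse, and the second coordinate is at free disposal.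
  let α : ℤ := h (u c₀)
  let f : Module.Dual ℤ N := h - (h ∘ₗ u) ∘ₗ r
    + (α • (LinearMap.proj 0 ∘ₗ T.toLinearMap) + LinearMap.proj 1 ∘ₗ T.toLinearMap) ∘ₗ r
  have hfD : f ∈ D := D.add_mem (D.sub_mem hD (hr _)) (hr _)
  have hfy : f y = 1 := by
    have h1 : h (u (r y)) = d * α := by rw [hry, map_smul, map_smul, smul_eq_mul]
    simp [f, hy, hT, h1]
    ring
  have hfu : ∀ c, f (u c) = α * T c 0 + T c 1 := fun c => by simp [f, hru]
  have hfc₁ : f (u c₁) = 1 := by simp [hfu, c₁]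
  let w : (Fin (t + 1) → ℤ) →ₗ[ℤ] (Fin (t + 2) → ℤ) := LinearMap.pi fun i =>
    if i = 1 then -α • LinearMap.proj 0 else LinearMap.proj (Fin.predAbove 0 i)
  let p : (Fin (t + 2) → ℤ) →ₗ[ℤ] (Fin (t + 1) → ℤ) :=
    LinearMap.pi fun i => LinearMap.proj ((1 : Fin (t + 2)).succAbove i)
  have hpw : ∀ c, p (w c) = c := fun c => by
    funext i
    have h1 : (1 : Fin (t + 2)).succAbove i ≠ 1 := Fin.succAbove_ne 1 i
    have h2 : Fin.predAbove 0 ((1 : Fin (t + 2)).succAbove i) = i := by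
      refine Fin.cases ?_ (fun i => ?_) i
      · simp
      · rw [Fin.succAbove_of_le_castSucc _ _ (by simp [Fin.le_def])]
        exact Fin.predAbove_zero_succ
    simp [p, w, h1, h2]
  let u' : (Fin (t + 1) → ℤ) →ₗ[ℤ] N := u ∘ₗ T.symm.toLinearMap ∘ₗ w
  have hfu' : ∀ c, f (u' c) = 0 := fun c => by simp [u', hfu, w]
  refine ⟨v - f v • u c₁, e - f e • u c₁, u', (p ∘ₗ T.toLinearMap) ∘ₗ (r - f.smulRight (r y)),
    φ - φ y • f, fun ξ => ⟨?_, ?_⟩, ⟨D.sub_mem hφD (D.smul_mem _ hfD), ?_⟩, fun c => ?_, fun c => ?_,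
    ?_, ?_, fun c => ?_, fun c => ?_⟩
  · have : ξ ∘ₗ (p ∘ₗ T.toLinearMap) ∘ₗ (r - f.smulRight (r y))
        = (ξ ∘ₗ p ∘ₗ T.toLinearMap) ∘ₗ r - ξ (p (T (r y))) • f := by
      ext x
      simp only [LinearMap.comp_apply, LinearMap.sub_apply, LinearMap.smulRight_apply, map_sub,
        map_smul, LinearMap.smul_apply, LinearEquiv.coe_coe, smul_eq_mul]
      ring
    rw [this]
    exact D.sub_mem (hr _) (D.smul_mem _ hfD)
  · rintro _ rfl
    simp [hfy]
  · rintro _ rfl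
    simp [hfy]
  · rw [LinearMap.comp_apply, LinearMap.sub_apply, LinearMap.smulRight_apply, hfu', zero_smul,
      sub_zero]
    simp [u', hru, hpw]
  · rw [LinearMap.sub_apply, LinearMap.smul_apply, hfu']
    simp [u', hφu]
  · simp [hφv, hφu, hfc₁]
  · simp [hφe, hφu, hfc₁]
  · convert hV (-f v • c₁ + T.symm (w c)) using 1
    simp only [u', map_add, map_smul, LinearMap.comp_apply, LinearEquiv.coe_coe]
    module
  · convert hVe (-f v • c₁ + -f e • c₁ + T.symm (w c)) using 1
    simp only [u', map_add, map_smul, LinearMap.comp_apply, LinearEquiv.coe_coe]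
    module

theorem HasAffinePair.vanishingOn_finset [DecidableEq N] {t : ℕ} (h : HasAffinePair t D V)
    (s : Finset N) (hsD : IsDualizable D s) (hs : s.card < t) :
    HasAffinePair (t - s.card) (vanishingOn D (s : Set N)) V := by
  induction s using Finset.induction_on with
  | empty => simpa [vanishingOn_empty] using h
  | insert y s hy ih =>
  rw [Finset.card_insert_of_notMem hy] at hs ⊢
  have ih := ih (hsD.mono (Finset.subset_insert _ _)) (by lia)
  rw [show t - s.card = t - (s.card + 2) + 2 by lia] at ih
  obtain ⟨g, hg, hgy, hgs⟩ := hsD y (Finset.mem_insert_self _ _)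
  have := ih.vanishingOn_singleton (y := y) (h := g)
    ⟨hg, fun x hx => hgs x (Finset.mem_insert_of_mem hx) fun hxy => hy (hxy ▸ hx)⟩ hgy
  rw [vanishingOn_vanishingOn, Set.union_singleton] at this
  rwa [Finset.coe_insert, show t - (s.card + 1) = t - (s.card + 2) + 1 by lia]

end Splitting

/-! ### Connectivity of complexes of unimodular sets -/

section Connectivity

variable {N : Type*} [AddCommGroup N]

/-- The inductive step from pairs of cosets to single cosets. -/
theorem HasAffineSummand.chainConnected_of_pair {t : ℕ}
    (ih : ∀ k < t, ∀ (D : Submodule ℤ (Module.Dual ℤ N)) (V : Set N), HasAffinePair k D V →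
      ChainConnected (dualizableFaces D V) ((k : ℤ) - 2))
    {D : Submodule ℤ (Module.Dual ℤ N)} {V : Set N} (h : HasAffineSummand t D V) :
    ChainConnected (dualizableFaces D V) ((t : ℤ) - 3) := by
  cases t with
  | zero => exact ChainConnected.of_le_neg_two (by simp)
  | succ k =>
    convert ih k (Nat.lt_succ_self k) D V h.hasAffinePair using 1
    push_cast
    ring

/-- The central induction. Let `Y` be the translate on which the functional `φ` vanishes, and `y` a
point of the translate on which `φ = 1`. Simplices in `Y` can be joined with `y`, so `Y ∪ {y}` spans
a cone. The other points of the second translate, and then all other vertices, are added with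
`chainConnected_of_links`. Modulo a vertex of the second translate, `Y` still contains a translate of
a summand of the full rank `t`, since the retraction can be corrected with `φ`. -/
theorem HasAffinePair.chainConnected [DecidableEq N] {t : ℕ} {D : Submodule ℤ (Module.Dual ℤ N)} {V : Set N}
    (h : HasAffinePair t D V) : ChainConnected (dualizableFaces D V) ((t : ℤ) - 2) := by
  induction t using Nat.strong_induction_on generalizing D V with
  | _ t ih =>
  have ih' : ∀ k < t, ∀ (D : Submodule ℤ (Module.Dual ℤ N)) (V : Set N), HasAffinePair k D V →
      ChainConnected (dualizableFaces D V) ((k : ℤ) - 2) := fun k hk _ _ h => ih k hk h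
  obtain ⟨v, e, u, r, φ, hr, hφD, hru, hφu, hφv, hφe, hV, hVe⟩ := h
  let Y : Set N := Set.range fun c => v + u c
  let Z : Set N := Set.range fun c => v + e + u c
  have hφY : ∀ x ∈ Y, φ x = 0 := by
    rintro _ ⟨c, rfl⟩
    simp [hφv, hφu]
  have hφZ : ∀ x ∈ Z, φ x = 1 := by
    rintro _ ⟨c, rfl⟩
    simp [hφv, hφu, hφe]
  have hyZ : v + e ∈ Z := ⟨0, by simp⟩
  have hZY : ∀ x ∈ Z, x ∉ Y := fun x hxZ hxY =>
    zero_ne_one ((hφY x hxY).symm.trans (hφZ x hxZ))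
  have hYlink : ∀ s : Finset N, s.Nonempty → (s : Set N) ⊆ Z →
      ChainConnected (dualizableFaces (vanishingOn D (s : Set N)) Y) ((t : ℤ) - 2 - s.card) := by
    rintro s ⟨x, hx⟩ hsZ
    have h1 : HasAffineSummand t (vanishingOn D {x}) Y := by
      refine ⟨v, u, r - φ.smulRight (r x), fun ξ => ⟨?_, ?_⟩, fun c => ?_, fun c => ⟨c, rfl⟩⟩
      · have : ξ ∘ₗ (r - φ.smulRight (r x)) = ξ ∘ₗ r - ξ (r x) • φ := by
          ext z
          simp only [LinearMap.comp_apply, LinearMap.sub_apply, LinearMap.smulRight_apply, map_sub,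
            map_smul, LinearMap.smul_apply, smul_eq_mul]
          ring
        rw [this]
        exact D.sub_mem (hr ξ) (D.smul_mem _ hφD)
      · intro y hy
        simp [Set.mem_singleton_iff.1 hy, hφZ x (hsZ hx)]
      · simp [hφu, hru]
    have hcard : (s.erase x).card + 1 = s.card := Finset.card_erase_add_one hx
    by_cases hs : (s.erase x).card ≤ t
    · have h2 := h1.vanishingOn_finset (s.erase x) hs
      rw [vanishingOn_vanishingOn, Set.singleton_union, ← Finset.coe_insert,
        Finset.insert_erase hx] at h2
      convert h2.chainConnected_of_pair fun k hk => ih' k (by lia) using 1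
      lia
    · exact ChainConnected.of_le_neg_two (by lia)
  have hcone : ChainConnected (dualizableFaces D (Y ∪ {v + e})) ((t : ℤ) - 2) := by
    refine ChainConnected.of_insert_mem (v := v + e) ?_ (fun s hs => ?_) _
    · refine ⟨Finset.singleton_nonempty _, by simp, fun x hx => ⟨φ, hφD, ?_, fun y hy hyx => ?_⟩⟩
      · rw [Finset.mem_singleton.1 hx]
        exact hφZ _ hyZ
      · exact absurd ((Finset.mem_singleton.1 hy).trans (Finset.mem_singleton.1 hx).symm) hyx
    · refine ⟨Finset.insert_nonempty _ _, ?_, ?_⟩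
      · rw [Finset.coe_insert]
        exact Set.insert_subset (Or.inr rfl) hs.2.1
      · have hφs : ∀ x ∈ s, x ≠ v + e → φ x = 0 := fun x hx hxe =>
          hφY x ((hs.2.1 hx).resolve_right hxe)
        intro x hx
        by_cases hxe : x = v + e
        · refine ⟨φ, hφD, hxe ▸ hφZ _ hyZ, fun y hy hyx => ?_⟩
          rw [hxe] at hyx
          exact hφs y (Finset.mem_of_mem_insert_of_ne hy hyx) hyx
        · have hxs := Finset.mem_of_mem_insert_of_ne hx hxe
          obtain ⟨g, hgD, hgx, hgs⟩ := hs.2.2 x hxs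
          refine ⟨g - g (v + e) • φ, D.sub_mem hgD (D.smul_mem _ hφD), ?_, fun y hy hyx => ?_⟩
          · simp [hφs x hxs hxe, hgx]
          · by_cases hye : y = v + e
            · rw [LinearMap.sub_apply, LinearMap.smul_apply, hye, hφZ _ hyZ]
              simp
            · have hys := Finset.mem_of_mem_insert_of_ne hy hye
              simp [hφs y hys hye, hgs y hys hyx]
  have hYZ : ChainConnected (dualizableFaces D (Y ∪ Z)) ((t : ℤ) - 2) := by
    refine chainConnected_of_links
      (Set.union_subset_union_right _ (Set.singleton_subset_iff.2 hyZ)) hcone fun s hs hsY => ?_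
    have hsub : ∀ s : Finset N, (s : Set N) ⊆ Y ∪ Z → Disjoint (s : Set N) Y → (s : Set N) ⊆ Z :=
      fun s hs hsY x hx => (hs hx).resolve_left (Set.disjoint_left.1 hsY hx)
    have hsY' := hsY.mono_right Set.subset_union_left
    refine chainConnected_of_links Set.subset_union_left (hYlink s hs.1 (hsub s hs.2.1 hsY'))
      fun s' hs' hs'Y => ?_
    rw [vanishingOn_vanishingOn, ← Finset.coe_union]
    convert hYlink (s ∪ s') (hs.1.mono Finset.subset_union_left) ?_ using 1
    · rw [Finset.card_union_of_disjoint hs'.2.2.disjoint]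
      push_cast
      ring
    · rw [Finset.coe_union]
      refine Set.union_subset (hsub s hs.2.1 hsY') (hsub s' (hs'.2.1.trans ?_) hs'Y)
      exact Set.union_subset_union_right _ (Set.singleton_subset_iff.2 hyZ)
  refine chainConnected_of_links (Set.union_subset ?_ ?_) hYZ fun s hs _ => ?_
  · rintro _ ⟨c, rfl⟩
    exact hV c
  · rintro _ ⟨c, rfl⟩
    exact hVe c
  · by_cases hst : s.card < t
    · have hpair : HasAffinePair t D (Y ∪ Z) :=
        ⟨v, e, u, r, φ, hr, hφD, hru, hφu, hφv, hφe, fun c => Or.inl ⟨c, rfl⟩,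
          fun c => Or.inr ⟨c, rfl⟩⟩
      have hs0 := hs.1.card_pos
      convert ih (t - s.card) (by lia) (hpair.vanishingOn_finset s hs.2.2 hst) using 1
      lia
    · exact ChainConnected.of_le_neg_two (by lia)

theorem HasAffineSummand.chainConnected [DecidableEq N] {t : ℕ} {D : Submodule ℤ (Module.Dual ℤ N)} {V : Set N}
    (h : HasAffineSummand t D V) : ChainConnected (dualizableFaces D V) ((t : ℤ) - 3) :=
  h.chainConnected_of_pair fun _ _ _ _ h => h.chainConnected

end Connectivity

/-! ### Face posets -/

section FacePoset

variable {ι : Type*} {K : PreAbstractSimplicialComplex ι}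

theorem height_face (x : {s : Finset ι // s ∈ K.faces}) :
    Order.height x = ((x.1.card - 1 : ℕ) : ℕ∞) := by
  classical
  obtain ⟨m, hm⟩ : ∃ m, x.1.card = m := ⟨_, rfl⟩
  induction m using Nat.strong_induction_on generalizing x with
  | _ m ih =>
  have hne : ∀ y : {s : Finset ι // s ∈ K.faces}, 0 < y.1.card := fun y =>
    (PreAbstractSimplicialComplex.nonempty_of_mem_faces y.2).card_pos
  refine le_antisymm (Order.height_le_coe_iff.2 fun y hy => ?_) ?_
  · have hcard : y.1.card < x.1.card := Finset.card_lt_card hy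
    rw [ih _ (hm ▸ hcard) y rfl]
    have := hne y
    exact_mod_cast (by lia : y.1.card - 1 < x.1.card - 1)
  · by_cases h1 : x.1.card = 1
    · simp [h1]
    · have h0 := hne x
      obtain ⟨i, hi⟩ := Finset.card_pos.1 h0
      have hcard := Finset.card_erase_add_one hi
      let y : {s : Finset ι // s ∈ K.faces} := ⟨x.1.erase i,
        PreAbstractSimplicialComplex.mem_faces_of_subset x.2 (Finset.erase_subset _ _)
          (Finset.card_pos.1 (by lia))⟩
      have hyx : y < x := Finset.erase_ssubset hi
      refine le_trans ?_ (Order.height_add_one_le hyx)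
      rw [ih _ (by rw [← hm]; exact Finset.card_lt_card hyx) y rfl]
      exact_mod_cast (by simp only [y]; lia : x.1.card - 1 ≤ y.1.card - 1 + 1)

/-- The conditions below a simplex and between two simplices hold in every simplicial complex, and
the elements above a simplex form the face poset of its link. -/
theorem isWeaklyCohenMacaulay_of_links [DecidableEq ι] {n : ℤ}
    (hK : ChainConnected K.faces (n - 1))
    (hlink : ∀ s ∈ K.faces, ChainConnected
      {t | t.Nonempty ∧ Disjoint s t ∧ s ∪ t ∈ K.faces} (n - 1 - s.card)) :
    IsWeaklyCohenMacaulay K n := by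
  have hheight : ∀ x : {s : Finset ι // s ∈ K.faces},
      ((Order.height x).toNat : ℤ) = x.1.card - 1 := fun x => by
    have := (PreAbstractSimplicialComplex.nonempty_of_mem_faces x.2).card_pos
    rw [height_face, ENat.toNat_natCast]
    lia
  have hsdiff : ∀ (s : Finset ι) (A : Set (Finset ι)), MonotoneOn (fun t => t \ s) A :=
    fun s A t _ t' _ htt' => Finset.sdiff_subset_sdiff htt' subset_rfl
  have hunion : ∀ (s : Finset ι) (A : Set (Finset ι)), MonotoneOn (fun t => s ∪ t) A :=
    fun s A t _ t' _ htt' => Finset.union_subset_union_right htt'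
  refine ⟨fun x => ?_, ⟨?_, fun x => ?_, fun x => ?_, fun x y hxy => ?_⟩⟩
  · rw [height_face]
    exact ENat.natCast_ne_top _
  · refine ChainConnected.isNConnectedPoset (OrderEmbedding.subtype _) ?_
    convert hK using 1
    exact Subtype.range_coe
  · refine ChainConnected.isNConnectedPoset
      ((OrderEmbedding.subtype (· ∈ Set.Iio x)).trans (OrderEmbedding.subtype _)) ?_
    rw [hheight]
    convert chainConnected_boundary x.1 using 1
    · ext s
      constructor
      · rintro ⟨y, rfl⟩
        exact ⟨PreAbstractSimplicialComplex.nonempty_of_mem_faces y.1.2, y.2⟩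
      · rintro ⟨h1, h2⟩
        exact ⟨⟨⟨s, PreAbstractSimplicialComplex.mem_faces_of_subset x.2 h2.subset h1⟩, h2⟩, rfl⟩
    · ring
  · refine ChainConnected.isNConnectedPoset
      ((OrderEmbedding.subtype (· ∈ Set.Ioi x)).trans (OrderEmbedding.subtype _)) ?_
    have hr : Set.range ((OrderEmbedding.subtype (· ∈ Set.Ioi x)).trans (OrderEmbedding.subtype _))
        = {s | s ∈ K.faces ∧ x.1 ⊂ s} := by
      ext s
      constructor
      · rintro ⟨y, rfl⟩
        exact ⟨y.1.2, y.2⟩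
      · rintro ⟨h1, h2⟩
        exact ⟨⟨⟨s, h1⟩, h2⟩, rfl⟩
    rw [hheight, hr]
    have := (hlink x.1 x.2).of_retract (A := {s | s ∈ K.faces ∧ x.1 ⊂ s}) (fun t => t \ x.1)
      (fun t => x.1 ∪ t) (hsdiff _ _) (hunion _ _) ?_ ?_ ?_
    · convert this using 1
      ring
    · rintro s ⟨h1, h2⟩
      refine ⟨Finset.sdiff_nonempty.2 h2.2, Finset.disjoint_sdiff, ?_⟩
      rwa [Finset.union_sdiff_of_subset h2.subset]
    · rintro s ⟨h1, h2, h3⟩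
      refine ⟨h3, Finset.ssubset_iff_subset_ne.2 ⟨Finset.subset_union_left, fun h => ?_⟩⟩
      obtain ⟨i, hi⟩ := h1
      exact Finset.disjoint_left.1 h2 (h ▸ Finset.mem_union_right _ hi) hi
    · exact fun s hs => Finset.union_sdiff_of_subset hs.2.subset
  · refine ChainConnected.isNConnectedPoset
      ((OrderEmbedding.subtype (· ∈ Set.Ioo x y)).trans (OrderEmbedding.subtype _)) ?_
    have hr : Set.range ((OrderEmbedding.subtype (· ∈ Set.Ioo x y)).trans (OrderEmbedding.subtype _))
        = {s | x.1 ⊂ s ∧ s ⊂ y.1} := by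
      ext s
      constructor
      · rintro ⟨z, rfl⟩
        exact ⟨z.2.1, z.2.2⟩
      · rintro ⟨h1, h2⟩
        exact ⟨⟨⟨s, PreAbstractSimplicialComplex.mem_faces_of_subset y.2 h2.subset
          ((PreAbstractSimplicialComplex.nonempty_of_mem_faces x.2).mono h1.subset)⟩, h1, h2⟩, rfl⟩
    have hxy' : x.1 ⊂ y.1 := hxy
    rw [hheight, hheight, hr]
    have := (chainConnected_boundary (y.1 \ x.1)).of_retract (A := {s | x.1 ⊂ s ∧ s ⊂ y.1})
      (fun t => t \ x.1) (fun t => x.1 ∪ t) (hsdiff _ _) (hunion _ _) ?_ ?_ ?_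
    · convert this using 1
      have := Finset.card_sdiff_add_card_eq_card hxy'.subset
      lia
    · rintro s ⟨h1, h2⟩
      refine ⟨Finset.sdiff_nonempty.2 h1.2, Finset.sdiff_subset_sdiff h2.subset subset_rfl,
        fun h => h2.2 ?_⟩
      rw [← Finset.union_sdiff_of_subset h1.subset, ← Finset.union_sdiff_of_subset hxy'.subset]
      exact Finset.union_subset_union_right h
    · rintro s ⟨h1, h2⟩
      have hd : Disjoint x.1 s := Finset.disjoint_sdiff.mono_right h2.subset
      refine ⟨Finset.ssubset_iff_subset_ne.2 ⟨Finset.subset_union_left, fun h => ?_⟩,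
        Finset.union_subset hxy'.subset (h2.subset.trans Finset.sdiff_subset), fun h => h2.2 ?_⟩
      · obtain ⟨i, hi⟩ := h1
        exact Finset.disjoint_left.1 hd (h ▸ Finset.mem_union_right _ hi) hi
      · intro i hi
        obtain ⟨hiy, hix⟩ := Finset.mem_sdiff.1 hi
        exact (Finset.mem_union.1 (h hiy)).resolve_left hix
    · exact fun s hs => Finset.union_sdiff_of_subset hs.1.subset

end FacePoset

/-! ### Unimodular vectors in a coset -/

section Unimodular

variable {N : Type*} [AddCommGroup N]

theorem isUnimodularSet_iff_isDualizable (s : Finset N) :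
    IsUnimodularSet ℤ s ↔ IsDualizable ⊤ s := by
  classical
  constructor
  · rintro ⟨hli, Q, hQ⟩ x hx
    have hspan : Submodule.span ℤ (s : Set N)
        = Submodule.span ℤ (Set.range fun i : (s : Set N) => id (i : N)) := by simp
    rw [hspan] at hQ
    let b := Module.Basis.span hli
    refine ⟨b.coord ⟨x, hx⟩ ∘ₗ Submodule.projectionOnto _ Q hQ, Submodule.mem_top, ?_⟩
    have hb : ∀ y (hy : y ∈ s), (b.coord ⟨x, hx⟩ ∘ₗ Submodule.projectionOnto _ Q hQ) y
        = Finsupp.single (⟨y, hy⟩ : (s : Set N)) (1 : ℤ) ⟨x, hx⟩ := fun y hy => by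
      have hby : (b ⟨y, hy⟩ : N) = y := Module.Basis.coe_span_apply hli ⟨y, hy⟩
      have : Submodule.projectionOnto _ Q hQ y = b ⟨y, hy⟩ := by
        rw [← Submodule.projectionOnto_apply_left hQ (b ⟨y, hy⟩), hby]
      rw [LinearMap.comp_apply, this, Module.Basis.coord_apply, Module.Basis.repr_self]
    refine ⟨?_, fun y hy hyx => ?_⟩
    · rw [hb x hx, Finsupp.single_eq_same]
    · rw [hb y hy, Finsupp.single_eq_of_ne]
      exact fun h => hyx (congrArg Subtype.val h).symm
  · intro h
    choose! g _ hg1 hg2 using h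
    have hgs : ∀ x ∈ s, ∀ c : N → ℤ, g x (∑ y ∈ s, c y • y) = c x := fun x hx c => by
      rw [map_sum, Finset.sum_eq_single_of_mem x hx fun y hy hyx => by
        rw [map_smul, hg2 x hx y hy hyx, smul_zero]]
      simp [hg1 x hx]
    refine ⟨?_, ?_⟩
    · rw [linearIndepOn_finset_iff]
      intro c hc x hx
      rw [← hgs x hx c]
      simp only [id] at hc
      rw [hc, map_zero]
    · let P : N →ₗ[ℤ] Submodule.span ℤ (s : Set N) :=
        ∑ x ∈ s.attach, (g x).smulRight ⟨x, Submodule.subset_span x.2⟩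
      refine ⟨LinearMap.ker P, LinearMap.isCompl_of_proj fun z => ?_⟩
      have hP : ∀ z, (P z : N) = ∑ x ∈ s, g x z • x := fun z => by
        simp only [P, LinearMap.sum_apply, AddSubmonoidClass.coe_finsetSum,
          LinearMap.smulRight_apply, Submodule.coe_smul]
        exact Finset.sum_attach s fun x => g x z • x
      obtain ⟨z, hz⟩ := z
      refine Subtype.ext ((hP z).trans ?_)
      induction hz using Submodule.span_induction with
      | mem x hx =>
        rw [Finset.sum_eq_single_of_mem x hx fun y hy hyx => by
          rw [hg2 y hy x hx hyx.symm, zero_smul], hg1 x hx, one_smul]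
      | zero => simp
      | add x y _ _ hx hy =>
        simp only [map_add, add_smul, Finset.sum_add_distrib] at hx hy ⊢
        rw [hx, hy]
      | smul c x _ hx =>
        simp only [map_smul, smul_eq_mul, mul_smul] at hx ⊢
        rw [← Finset.smul_sum, hx]

theorem faces_unimodularComplex (N' : Submodule ℤ N) (δ : N ⧸ N') :
    (unimodularComplex N' δ).faces = dualizableFaces ⊤ {x | Submodule.Quotient.mk x = δ} := by
  ext s
  constructor
  · rintro ⟨h1, h2, h3⟩
    exact ⟨h1, fun x hx => (h2 x hx).2, (isUnimodularSet_iff_isDualizable s).1 h3⟩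
  · rintro ⟨h1, h2, h3⟩
    have h3' := (isUnimodularSet_iff_isDualizable s).2 h3
    exact ⟨h1, fun x hx => ⟨h3'.mono (Finset.singleton_subset_iff.2 hx), h2 hx⟩, h3'⟩

theorem hasAffineSummand_summandRank [Module.Free ℤ N] [Module.Finite ℤ N] (N' : Submodule ℤ N)
    (δ : N ⧸ N') :
    HasAffineSummand (summandRank N') ⊤ {x | (Submodule.Quotient.mk x : N ⧸ N') = δ} := by
  obtain ⟨U, hUN', ⟨Q, hQ⟩, hU⟩ := (summandRank_isGreatest N').1
  obtain ⟨v, hv⟩ := Submodule.Quotient.mk_surjective N' δ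
  let b : Module.Basis (Fin (summandRank N')) ℤ U := Module.finBasisOfFinrankEq ℤ U hU
  refine ⟨v, U.subtype ∘ₗ b.equivFun.symm.toLinearMap,
    b.equivFun.toLinearMap ∘ₗ Submodule.projectionOnto U Q hQ, fun _ => Submodule.mem_top,
    fun c => ?_, fun c => ?_⟩
  · simp only [LinearMap.comp_apply, LinearEquiv.coe_coe, Submodule.subtype_apply,
      Submodule.projectionOnto_apply_left, LinearEquiv.apply_symm_apply]
  · change Submodule.Quotient.mk _ = δ
    rw [← hv, Submodule.Quotient.eq]
    simpa using hUN' (b.equivFun.symm c).2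

theorem isWeaklyCohenMacaulay_unimodularComplex {N : Type*} [AddCommGroup N] [inst : Module ℤ N]
    [Module.Free ℤ N] [Module.Finite ℤ N] (N' : Submodule ℤ N) (δ : N ⧸ N') :
    IsWeaklyCohenMacaulay (unimodularComplex N' δ) ((summandRank N' : ℤ) - 2) := by
  classical
  -- All `ℤ`-module structures on `N` agree, so that the canonical one may be assumed.
  obtain rfl : inst = AddCommGroup.toIntModule N := Subsingleton.elim _ _
  have h := hasAffineSummand_summandRank N' δ
  refine isWeaklyCohenMacaulay_of_links ?_ fun s hs => ?_
  · rw [faces_unimodularComplex]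
    convert h.chainConnected using 1
    ring
  · rw [faces_unimodularComplex] at hs ⊢
    have hlink : {t | t.Nonempty ∧ Disjoint s t ∧
        s ∪ t ∈ dualizableFaces ⊤ {x | (Submodule.Quotient.mk x : N ⧸ N') = δ}}
        = dualizableFaces (vanishingOn ⊤ (s : Set N))
          {x | (Submodule.Quotient.mk x : N ⧸ N') = δ} := by
      ext t
      constructor
      · rintro ⟨h1, h2, h3⟩
        exact ⟨h1, fun x hx => h3.2.1 (Finset.mem_union_right _ hx), h3.2.2.of_union_left h2⟩
      · rintro ⟨h1, h2, h3⟩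
        refine ⟨h1, h3.disjoint, hs.1.mono Finset.subset_union_left, ?_, hs.2.2.union h3⟩
        rw [Finset.coe_union]
        exact Set.union_subset hs.2.1 h2
    rw [hlink]
    by_cases hst : s.card ≤ summandRank N'
    · convert (h.vanishingOn_finset s hst).chainConnected using 1
      lia
    · exact ChainConnected.of_le_neg_two (by lia)

end Unimodular

theorem mainTheorem9 :
    (∀ (N : Type u) [AddCommGroup N] [Module ℤ N] [Module.Free ℤ N] [Module.Finite ℤ N]
        (N' : Submodule ℤ N) (δ : N ⧸ N'),
        IsWeaklyCohenMacaulay (unimodularComplex N' δ) ((summandRank N' : ℤ) - 2)) ∧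
      (∀ (M : Type v) [AddCommGroup M] [Module ℤ M] [Module.Free ℤ M] [Module.Finite ℤ M]
        (D : AlgebraicData M),
        IsWeaklyCohenMacaulay D.arcComplex ((D.t : ℤ) - 2)) := by
  exact ⟨fun N _ _ _ _ N' δ => isWeaklyCohenMacaulay_unimodularComplex N' δ,
    fun M _ _ _ _ D => isWeaklyCohenMacaulay_unimodularComplex (LinearMap.range D.form) D.δ⟩
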